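/- Let $p$ be a prime and let $n\ge 1$ be an integer. A generalized Poincaré duality (GPD) group of dimension $n$ is an infinite pro-$p$ group $G$ such that $H^n(G,\mathbb{F}_p)\cong\mathbb{F}_p$ and such that for every $0\le i\le n$ the cup product pairing $H^i(G,\mathbb{F}_p)\times H^{n-i}(G,\mathbb{F}_p)\to H^n(G,\mathbb{F}_p)$ is nondegenerate, i.e. has trivial left and right kernels (here $\mathbb{F}_p$ carries the trivial action and $H^\bullet$ denotes continuous cohomology; the groups $H^i(G,\mathbb{F}_p)$ with $0<i<n$ may be infinite). The cohomological dimension $\operatorname{cd}(H)$ of a profinite group $H$ is the least integer $m\ge 0$ such that $H^q(H,A)=0$ for all $q>m$ and all discrete torsion $H$-modules $A$, and $\infty$ if there is no such $m$. If $G$ is a GPD group of dimension $n$ and $H\le G$ is a closed subgroup of infinite index, then $\operatorname{cd}(H)<n$. -/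

import Mathlib

universe u v

/-! ### Cohomology of topological groups with discrete coefficients

A `G`-module is an abelian group `A` with `ρ : Representation ℤ G A`. -/

namespace ProfiniteCohomology

section Cochains

variable {G : Type u} [Group G] [TopologicalSpace G]
  {A : Type v} [AddCommGroup A] (ρ : Representation ℤ G A)

/-- `A` is a discrete `G`-module: all point stabilizers are open, that is, the action
`G × A → A` is continuous for the discrete topology on `A`. -/
def IsDiscreteModule : Prop :=
  ∀ a : A, IsOpen {g : G | ρ g a = a}

/-- The group `Cⁿ(G, A)` of homogeneous continuous `n`-cochains: the continuous (for the discrete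
topology on `A`, i.e. locally constant) maps `f : Gⁿ⁺¹ → A` such that
`f (g x₀, …, g xₙ) = g f (x₀, …, xₙ)`. -/
def cochains (n : ℕ) : Submodule ℤ ((Fin (n + 1) → G) → A) where
  carrier := {f | IsLocallyConstant f ∧ ∀ (g : G) (x : Fin (n + 1) → G),
    f (fun i => g * x i) = ρ g (f x)}
  add_mem' := by
    rintro f h ⟨hf, hf'⟩ ⟨hh, hh'⟩
    exact ⟨hf.add hh, fun g x => by simp [hf', hh']⟩
  zero_mem' := ⟨IsLocallyConstant.const 0, fun g x => by simp⟩
  smul_mem' := by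
    rintro c f ⟨hf, hf'⟩
    exact ⟨hf.comp (fun a => c • a), fun g x => by simp [hf']⟩

variable {ρ} in
theorem sum_face_mem {n : ℕ} (f : cochains ρ n) :
    (fun x : Fin (n + 2) → G => ∑ i : Fin (n + 2),
      (-1 : ℤ) ^ (i : ℕ) • f.1 (fun j => x (i.succAbove j))) ∈ cochains ρ (n + 1) := by
  have h : (fun x : Fin (n + 2) → G => ∑ i : Fin (n + 2),
      (-1 : ℤ) ^ (i : ℕ) • f.1 (fun j => x (i.succAbove j))) = ∑ i : Fin (n + 2),
      fun x : Fin (n + 2) → G => (-1 : ℤ) ^ (i : ℕ) • f.1 (fun j => x (i.succAbove j)) := by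
    ext x; simp
  refine ⟨?_, fun g x => ?_⟩
  · rw [h]
    refine Finset.sum_induction _ IsLocallyConstant (fun _ _ h₁ h₂ => h₁.add h₂)
      (IsLocallyConstant.const 0) fun i _ => ?_
    have hc : Continuous fun (x : Fin (n + 2) → G) (j : Fin (n + 1)) => x (i.succAbove j) := by
      fun_prop
    exact (f.2.1.comp_continuous hc).comp (fun a => (-1 : ℤ) ^ (i : ℕ) • a)
  · simp only [map_sum, map_zsmul]
    exact Finset.sum_congr rfl fun i _ => by rw [← f.2.2]

/-- The coboundary map `Cⁿ(G, A) → Cⁿ⁺¹(G, A)`,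
`(d f)(x₀, …, xₙ₊₁) = ∑ᵢ (-1)ⁱ f (x₀, …, x̂ᵢ, …, xₙ₊₁)`. -/
def d (n : ℕ) : cochains ρ n →ₗ[ℤ] cochains ρ (n + 1) where
  toFun f := ⟨fun x => ∑ i : Fin (n + 2),
    (-1 : ℤ) ^ (i : ℕ) • f.1 (fun j => x (i.succAbove j)), sum_face_mem f⟩
  map_add' f h := by
    ext x
    simp [Finset.sum_add_distrib]
  map_smul' c f := by
    ext x
    simp [Finset.smul_sum, smul_comm c]

/-- The group `Zⁿ(G, A)` of `n`-cocycles. -/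
def cocycles (n : ℕ) : Submodule ℤ (cochains ρ n) :=
  LinearMap.ker (d ρ n)

/-- The group `Bⁿ(G, A)` of `n`-coboundaries. -/
def coboundaries : (n : ℕ) → Submodule ℤ (cochains ρ n)
  | 0 => ⊥
  | n + 1 => LinearMap.range (d ρ n)

theorem d_d (n : ℕ) (f : cochains ρ n) : d ρ (n + 1) (d ρ n f) = 0 := by
  ext x
  change ∑ i : Fin (n + 3), (-1 : ℤ) ^ (i : ℕ) • ∑ j : Fin (n + 2),
    (-1 : ℤ) ^ (j : ℕ) • f.1 (fun l => x (i.succAbove (j.succAbove l))) = 0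
  simp only [Finset.smul_sum, smul_smul, ← pow_add]
  rw [← Finset.sum_product', Finset.univ_product_univ]
  refine Finset.sum_involution (fun ij _ => (ij.1.succAbove ij.2, ij.2.predAbove ij.1))
    ?_ ?_ (fun _ _ => Finset.mem_univ _) ?_
  · rintro ⟨i, j⟩ -
    simp only [Fin.succAbove_succAbove_succAbove_predAbove]
    rw [Fin.neg_one_pow_succAbove_add_predAbove, neg_smul, add_neg_cancel]
  · rintro ⟨i, j⟩ - - h
    exact Fin.succAbove_ne i j (congrArg Prod.fst h)
  · rintro ⟨i, j⟩ -
    exact Prod.ext (Fin.succAbove_succAbove_predAbove i j) (Fin.predAbove_predAbove_succAbove i j)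

theorem coboundaries_le_cocycles (n : ℕ) : coboundaries ρ n ≤ cocycles ρ n := by
  cases n with
  | zero => exact bot_le
  | succ n =>
    rintro _ ⟨f, rfl⟩
    exact d_d ρ n f

/-- The cohomology group `Hⁿ(G, A) = Zⁿ(G, A) / Bⁿ(G, A)`. -/
abbrev cohomology (n : ℕ) : Type (max u v) :=
  cocycles ρ n ⧸ (coboundaries ρ n).submoduleOf (cocycles ρ n)

end Cochains

section Cup

variable {G : Type u} [Group G] [TopologicalSpace G]
  {A B C : Type*} [AddCommGroup A] [AddCommGroup B] [AddCommGroup C]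
  {ρ : Representation ℤ G A} {σ : Representation ℤ G B} {τ : Representation ℤ G C}
  (β : A →ₗ[ℤ] B →ₗ[ℤ] C) (hβ : ∀ g a b, β (ρ g a) (σ g b) = τ g (β a b))

/-- The cup product of cochains with respect to a `G`-equivariant bilinear map `β : A × B → C`, in
degrees `i + j = n`: `(f ∪ h)(x₀, …, xₙ) = β (f (x₀, …, xᵢ)) (h (xᵢ, …, xₙ))`. -/
def cupCochains {i j n : ℕ} (hn : i + j = n) :
    cochains ρ i →ₗ[ℤ] cochains σ j →ₗ[ℤ] cochains τ n :=
  LinearMap.mk₂ ℤ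
    (fun f h => ⟨fun x => β (f.1 fun a => x ⟨a, by omega⟩) (h.1 fun b => x ⟨i + b, by omega⟩), by
      refine ⟨?_, fun g x => ?_⟩
      · have h₁ := f.2.1.comp_continuous (f := fun (x : Fin (n + 1) → G) (a : Fin (i + 1)) =>
          x ⟨a, by omega⟩) (by fun_prop)
        have h₂ := h.2.1.comp_continuous (f := fun (x : Fin (n + 1) → G) (b : Fin (j + 1)) =>
          x ⟨i + b, by omega⟩) (by fun_prop)
        exact h₁.comp₂ h₂ (fun a b => β a b)
      · change β (f.1 fun a => g * x ⟨a, _⟩) (h.1 fun b => g * x ⟨i + b, _⟩) = τ g (β _ _)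
        rw [f.2.2 g fun a => x ⟨a, by omega⟩, h.2.2 g fun b => x ⟨i + b, by omega⟩, hβ]⟩)
    (fun f f' h => by ext x; simp)
    (fun c f h => by ext x; simp)
    (fun f h h' => by ext x; simp)
    (fun c f h => by ext x; simp)

theorem d_cup {i j m : ℕ} (hm : i + j = m) (f : cochains ρ i) (h : cochains σ j) :
    d τ m (cupCochains β hβ hm f h) =
      cupCochains β hβ (show (i + 1) + j = m + 1 by omega) (d ρ i f) h +
      (-1 : ℤ) ^ i • cupCochains β hβ (show i + (j + 1) = m + 1 by omega) f (d σ j h) := by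
  subst hm
  ext x
  -- extend `x` to a sequence `y`, and write `δ a` for the omission of the `a`-th entry
  obtain ⟨y, hy⟩ : ∃ y : ℕ → G, ∀ (k : ℕ) (hk : k < i + j + 2), x ⟨k, hk⟩ = y k :=
    ⟨fun k => if hk : k < i + j + 2 then x ⟨k, hk⟩ else 1, fun k hk => by simp [hk]⟩
  let δ : ℕ → ℕ → ℕ := fun a k => if k < a then k else k + 1
  have hδ : ∀ {N : ℕ} (a : Fin (N + 1)) (k : Fin N), ((a.succAbove k : Fin (N + 1)) : ℕ) = δ a k := by
    intro N a k
    simp only [δ, Fin.succAbove, Fin.lt_def, Fin.val_castSucc]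
    split_ifs <;> simp
  have hx : ∀ k : Fin (i + j + 2), x k = y k := fun k => hy k k.2
  let F : (ℕ → G) → A := fun z => f.1 fun a => z a
  let H : (ℕ → G) → B := fun z => h.1 fun b => z b
  have e₁ : (d τ (i + j) (cupCochains β hβ rfl f h)).1 x =
      ∑ a ∈ Finset.range ((i + 1) + (j + 1)), (-1 : ℤ) ^ a •
        β (F fun k => y (δ a k)) (H fun k => y (δ a (i + k))) := by
    rw [show (i + 1) + (j + 1) = i + j + 2 by omega, Finset.sum_range]
    change ∑ a : Fin (i + j + 2), (-1 : ℤ) ^ (a : ℕ) •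
      (cupCochains β hβ rfl f h).1 (fun k => x (a.succAbove k)) = _
    refine Finset.sum_congr rfl fun a _ => ?_
    simp only [cupCochains, LinearMap.mk₂_apply, hx, hδ, F, H]
  have e₂ : (cupCochains β hβ (show (i + 1) + j = i + j + 1 by omega) (d ρ i f) h).1 x =
      ∑ a ∈ Finset.range (i + 2), (-1 : ℤ) ^ a •
        β (F fun k => y (δ a k)) (H fun k => y (i + 1 + k)) := by
    rw [Finset.sum_range]
    simp only [cupCochains, LinearMap.mk₂_apply, d, LinearMap.coe_mk, AddHom.coe_mk, map_sum,
      LinearMap.sum_apply, map_smul, LinearMap.smul_apply, hx, hδ, F, H]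
  have e₃ : (cupCochains β hβ (show i + (j + 1) = i + j + 1 by omega) f (d σ j h)).1 x =
      ∑ a ∈ Finset.range (j + 2), (-1 : ℤ) ^ a •
        β (F fun k => y k) (H fun k => y (i + δ a k)) := by
    rw [Finset.sum_range]
    simp only [cupCochains, LinearMap.mk₂_apply, d, LinearMap.coe_mk, AddHom.coe_mk, map_sum,
      map_smul, hx, hδ, F, H]
  change (d τ (i + j) (cupCochains β hβ rfl f h)).1 x =
    (cupCochains β hβ (show (i + 1) + j = i + j + 1 by omega) (d ρ i f) h).1 x +
    (-1 : ℤ) ^ i • (cupCochains β hβ (show i + (j + 1) = i + j + 1 by omega) f (d σ j h)).1 x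
  rw [e₁, e₂, e₃, Finset.sum_range_add, Finset.sum_range_succ _ (i + 1),
    Finset.sum_range_succ' _ (j + 1)]
  have s₁ : ∀ a ∈ Finset.range (i + 1), (-1 : ℤ) ^ a •
      β (F fun k => y (δ a k)) (H fun k => y (δ a (i + k))) =
      (-1 : ℤ) ^ a • β (F fun k => y (δ a k)) (H fun k => y (i + 1 + k)) := by
    intro a ha
    rw [Finset.mem_range] at ha
    have : ∀ k, δ a (i + k) = i + 1 + k := fun k => by simp only [δ]; split_ifs <;> omega
    simp only [this]
  have hF : ∀ a, i + 1 ≤ a → (F fun k => y (δ a k)) = F fun k => y k := by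
    intro a ha
    refine congrArg f.1 (funext fun k => congrArg y ?_)
    exact if_pos (by omega)
  have s₂ : ∀ a ∈ Finset.range (j + 1), (-1 : ℤ) ^ (i + 1 + a) •
      β (F fun k => y (δ (i + 1 + a) k)) (H fun k => y (δ (i + 1 + a) (i + k))) =
      (-1 : ℤ) ^ i • (-1 : ℤ) ^ (a + 1) • β (F fun k => y k) (H fun k => y (i + δ (a + 1) k)) := by
    intro a _
    have : ∀ k, δ (i + 1 + a) (i + k) = i + δ (a + 1) k := fun k => by
      simp only [δ]; split_ifs <;> omega
    rw [hF _ (by omega), smul_smul, ← pow_add]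
    simp only [this]
    congr 2
    omega
  have s₃ : ∀ k, i + δ 0 k = i + 1 + k := fun k => by simp only [δ]; split_ifs <;> omega
  rw [Finset.sum_congr rfl s₁, Finset.sum_congr rfl s₂, hF _ le_rfl, smul_add, Finset.smul_sum]
  simp only [s₃, pow_succ, mul_neg, mul_one, neg_smul, pow_zero, one_smul]
  abel

theorem cup_mem_cocycles {i j n : ℕ} (hn : i + j = n) {f : cochains ρ i} (hf : f ∈ cocycles ρ i)
    {h : cochains σ j} (hh : h ∈ cocycles σ j) : cupCochains β hβ hn f h ∈ cocycles τ n := by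
  rw [cocycles, LinearMap.mem_ker] at *
  rw [d_cup, hf, hh]
  simp

theorem cup_mem_left {i j n : ℕ} (hn : i + j = n) {f : cochains ρ i} (hf : f ∈ coboundaries ρ i)
    {h : cochains σ j} (hh : h ∈ cocycles σ j) : cupCochains β hβ hn f h ∈ coboundaries τ n := by
  rw [cocycles, LinearMap.mem_ker] at hh
  cases i with
  | zero =>
    rw [coboundaries, Submodule.mem_bot] at hf
    simp [hf]
  | succ i =>
    obtain ⟨e, rfl⟩ := hf
    obtain ⟨m, rfl⟩ : ∃ m, n = m + 1 := ⟨i + j, by omega⟩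
    refine ⟨cupCochains β hβ (by omega) e h, ?_⟩
    rw [d_cup, hh]
    simp

theorem cup_mem_right {i j n : ℕ} (hn : i + j = n) {f : cochains ρ i} (hf : f ∈ cocycles ρ i)
    {h : cochains σ j} (hh : h ∈ coboundaries σ j) :
    cupCochains β hβ hn f h ∈ coboundaries τ n := by
  rw [cocycles, LinearMap.mem_ker] at hf
  cases j with
  | zero =>
    rw [coboundaries, Submodule.mem_bot] at hh
    simp [hh]
  | succ j =>
    obtain ⟨e, rfl⟩ := hh
    obtain ⟨m, rfl⟩ : ∃ m, n = m + 1 := ⟨i + j, by omega⟩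
    refine ⟨(-1 : ℤ) ^ i • cupCochains β hβ (by omega) f e, ?_⟩
    rw [map_smul, d_cup, hf]
    simp [smul_smul, ← mul_pow]

/-- The cup product of cocycles. -/
def cupCocycles {i j n : ℕ} (hn : i + j = n) :
    cocycles ρ i →ₗ[ℤ] cocycles σ j →ₗ[ℤ] cocycles τ n :=
  LinearMap.mk₂ ℤ
    (fun f h => ⟨cupCochains β hβ hn f.1 h.1, cup_mem_cocycles β hβ hn f.2 h.2⟩)
    (fun f f' h => Subtype.ext (LinearMap.map_add₂ _ f.1 f'.1 h.1))
    (fun c f h => Subtype.ext (LinearMap.map_smul₂ _ c f.1 h.1))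
    (fun f h h' => Subtype.ext (map_add (cupCochains β hβ hn f.1) h.1 h'.1))
    (fun c f h => Subtype.ext (map_smul (cupCochains β hβ hn f.1) c h.1))

/-- The cup product `Hⁱ(G, A) × Hʲ(G, B) → Hⁿ(G, C)`, `i + j = n`, with respect to a
`G`-equivariant bilinear map `β : A × B → C`. -/
def cup {i j n : ℕ} (hn : i + j = n) :
    cohomology ρ i →ₗ[ℤ] cohomology σ j →ₗ[ℤ] cohomology τ n :=
  LinearMap.liftQ₂ _ _
    ((cupCocycles β hβ hn).compr₂ ((coboundaries τ n).submoduleOf (cocycles τ n)).mkQ)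
    (fun _ hf => LinearMap.mem_ker.2 <| LinearMap.ext fun h =>
      (Submodule.Quotient.mk_eq_zero _).2 (cup_mem_left β hβ hn hf h.2))
    (fun _ hh => LinearMap.mem_ker.2 <| LinearMap.ext fun f =>
      (Submodule.Quotient.mk_eq_zero _).2 (cup_mem_right β hβ hn f.2 hh))

end Cup

section TrivialCoefficients

variable (p : ℕ) (G : Type u) [Group G] [TopologicalSpace G]

/-- The trivial `G`-module `𝔽_p`. -/
abbrev trivialModule : Representation ℤ G (ZMod p) :=
  Representation.trivial ℤ G (ZMod p)

/-- The cup product `Hⁱ(G, 𝔽_p) × Hʲ(G, 𝔽_p) → Hⁿ(G, 𝔽_p)`, `i + j = n`, induced by the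
multiplication of `𝔽_p`. -/
def cupZMod {i j n : ℕ} (hn : i + j = n) :
    cohomology (trivialModule p G) i →ₗ[ℤ] cohomology (trivialModule p G) j →ₗ[ℤ]
      cohomology (trivialModule p G) n :=
  cup (LinearMap.mul ℤ (ZMod p)) (fun _ _ _ => rfl) hn

end TrivialCoefficients

section Dimension

variable (G : Type u) [Group G] [TopologicalSpace G]

/-- The cohomological dimension of `G`: the least `n` such that `H^q(G, A) = 0` for all `q > n` and
all discrete torsion `G`-modules `A`, and `⊤` if there is no such `n`. -/
noncomputable def cd : ℕ∞ :=
  sInf {m : ℕ∞ | ∀ (A : Type u) [AddCommGroup A] (ρ : Representation ℤ G A),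
    IsDiscreteModule ρ → IsAddTorsion A →
      ∀ q : ℕ, m < q → Subsingleton (cohomology ρ q)}

end Dimension

section PoincareDuality

/-- `G` is a pro-`p` group: a profinite group all of whose quotients by open normal subgroups are
(finite) `p`-groups. -/
structure IsProP (p : ℕ) (G : Type u) [Group G] [TopologicalSpace G] : Prop where
  isTopologicalGroup : IsTopologicalGroup G
  compactSpace : CompactSpace G
  t2Space : T2Space G
  totallyDisconnectedSpace : TotallyDisconnectedSpace G
  isPGroup_quotient : ∀ (U : Subgroup G) [U.Normal], IsOpen (U : Set G) → IsPGroup p (G ⧸ U)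

/-- `G` is a generalized Poincaré duality (GPD) group of dimension `n` (at the prime `p`). -/
structure IsGPD (p n : ℕ) (G : Type u) [Group G] [TopologicalSpace G] : Prop where
  isProP : IsProP p G
  infinite : Infinite G
  top_cohomology : Nonempty (cohomology (trivialModule p G) n ≃+ ZMod p)
  nondegenerate : ∀ (i j : ℕ) (hn : i + j = n), (cupZMod p G hn).Nondegenerate

end PoincareDuality

end ProfiniteCohomology

/-! Write `n = m + 1`. It suffices that `H^n(H, 𝔽_p) = 0`: dévissage extends this to all discrete
torsion modules in degree `n`, and dimension shifting by coinduced modules to all higher degrees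
(`isAcyclic_add`).

The duality input is `IsGPD.mem_coboundaries`: for a finite discrete `A` killed by `p`, a class in
`H^n(G, A)` vanishes once all its images in `H^n(G, 𝔽_p)` under `Hom_G(A, 𝔽_p)` vanish. Induct on
`|A|` along `0 → B → A → 𝔽_p → 0`. The class lifts to `c` in `H^n(G, B)`, and `c` may be changed by
`b ∪ e`, with `e` the extension class and `b` in `H^m(G, 𝔽_p)`. Nondegeneracy provides a `b` making
`c - b ∪ e` invisible to `Hom_G(B, 𝔽_p)`. The forms being matched range over a finite space, so
infinite cohomology groups do no harm.

For `H` closed of infinite index (`IsGPD.isAcyclic_subgroup`), a cocycle `f` on `H` factors through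
`H/(H ∩ W)` for some open normal `W` of `G`. A Shapiro-type construction extends it to a cocycle on
`G` with values in the functions on `G ⧸ HW`. Choose an open `V` with `H ≤ V ≤ HW` and `p ∣ [HW :
V]`. Invariant forms on functions on `G ⧸ V` are multiples of the sum, hence kill functions pulled
back from `G ⧸ HW`. By duality the pulled-back cocycle is a coboundary; evaluating at the trivial
coset and restricting to `H` bounds `f`. -/

namespace ProfiniteCohomology

/-! ### Change of coefficients and short exact sequences of cochains -/

section Functoriality

variable {G : Type*} [Group G] [TopologicalSpace G]
  {A B C : Type*} [AddCommGroup A] [AddCommGroup B] [AddCommGroup C]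
  {ρ : Representation ℤ G A} {σ : Representation ℤ G B} {τ : Representation ℤ G C}

/-- The map on cochains induced by a `G`-equivariant homomorphism. -/
def mapCochains (φ : A →ₗ[ℤ] B) (hφ : ∀ g a, φ (ρ g a) = σ g (φ a)) (n : ℕ) :
    cochains ρ n →ₗ[ℤ] cochains σ n where
  toFun f := ⟨fun x => φ (f.1 x), f.2.1.comp φ, fun g x => by
    change φ (f.1 _) = _
    rw [f.2.2, hφ]⟩
  map_add' f h := by ext x; simp
  map_smul' c f := by ext x; simp

theorem d_mapCochains (φ : A →ₗ[ℤ] B) (hφ : ∀ g a, φ (ρ g a) = σ g (φ a)) (n : ℕ)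
    (f : cochains ρ n) : d σ n (mapCochains φ hφ n f) = mapCochains φ hφ (n + 1) (d ρ n f) := by
  ext x
  simp [d, mapCochains]

theorem mapCochains_injective {φ : A →ₗ[ℤ] B} (hφ : ∀ g a, φ (ρ g a) = σ g (φ a))
    (hinj : Function.Injective φ) (n : ℕ) : Function.Injective (mapCochains φ hφ n) :=
  fun _ _ h => Subtype.ext (funext fun x => hinj (congrFun (congrArg Subtype.val h) x))

theorem exists_mapCochains_eq_of_forall_mem_range {φ : A →ₗ[ℤ] B}
    (hφ : ∀ g a, φ (ρ g a) = σ g (φ a)) (hinj : Function.Injective φ) {n : ℕ}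
    (f : cochains σ n) (hf : ∀ x, f.1 x ∈ LinearMap.range φ) :
    ∃ h : cochains ρ n, mapCochains φ hφ n h = f := by
  choose h hh using hf
  refine ⟨⟨h, ?_, fun g x => hinj ?_⟩, Subtype.ext (funext hh)⟩
  · refine IsLocallyConstant.desc h φ ?_ hinj
    convert f.2.1 using 1
    exact funext hh
  · rw [hh, hφ, hh, f.2.2]

/-- A set-theoretic section `s` need not be equivariant, so translate the first argument to `1`,
apply `s`, and translate back. Discreteness of `A` keeps the result locally constant. -/
theorem exists_mapCochains_eq_of_surjective [IsTopologicalGroup G] {φ : A →ₗ[ℤ] B}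
    (hφ : ∀ g a, φ (ρ g a) = σ g (φ a)) (hsurj : Function.Surjective φ)
    (hρ : IsDiscreteModule ρ) {n : ℕ} (f : cochains σ n) :
    ∃ h : cochains ρ n, mapCochains φ hφ n h = f := by
  obtain ⟨s, hs⟩ := hsurj.hasRightInverse
  refine ⟨⟨fun x => ρ (x 0) (s (f.1 fun i => (x 0)⁻¹ * x i)), ?_, fun g x => ?_⟩, ?_⟩
  · rw [IsLocallyConstant.iff_eventually_eq]
    intro x
    have h₁ : ∀ᶠ y in nhds x, f.1 (fun i => (y 0)⁻¹ * y i) = f.1 fun i => (x 0)⁻¹ * x i :=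
      (f.2.1.comp_continuous (f := fun (x : Fin (n + 1) → G) i => (x 0)⁻¹ * x i)
        (by fun_prop)).eventually_eq x
    have h₂ : ∀ b : A, ∀ᶠ y : Fin (n + 1) → G in nhds x, ρ ((x 0)⁻¹ * y 0) b = b := by
      intro b
      have hc : Continuous fun y : Fin (n + 1) → G => (x 0)⁻¹ * y 0 := by fun_prop
      exact hc.continuousAt.eventually_mem ((hρ b).mem_nhds (by simp))
    filter_upwards [h₁, h₂ (s (f.1 fun i => (x 0)⁻¹ * x i))] with y hy₁ hy₂
    rw [hy₁]
    have := congrArg (ρ (x 0)) hy₂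
    rwa [← Module.End.mul_apply, ← map_mul, mul_inv_cancel_left] at this
  · simp [mul_assoc]
  · ext x
    change φ (ρ (x 0) _) = f.1 x
    rw [hφ, hs, ← f.2.2]
    simp

variable (ρ) in
/-- Every continuous `(n + 1)`-cocycle with values in `A` is a coboundary. -/
def IsAcyclic (n : ℕ) : Prop :=
  ∀ f : cochains ρ (n + 1), d ρ (n + 1) f = 0 → ∃ e : cochains ρ n, d ρ n e = f

theorem IsAcyclic.subsingleton {n : ℕ} (h : IsAcyclic ρ n) : Subsingleton (cohomology ρ (n + 1)) := by
  rw [Submodule.Quotient.subsingleton_iff, eq_top_iff]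
  rintro ⟨f, hf⟩ -
  exact h f hf

theorem IsAcyclic.of_exact [IsTopologicalGroup G] {ι : A →ₗ[ℤ] B} {π : B →ₗ[ℤ] C}
    (hι : ∀ g a, ι (ρ g a) = σ g (ι a)) (hπ : ∀ g a, π (σ g a) = τ g (π a))
    (hinj : Function.Injective ι) (hsurj : Function.Surjective π)
    (hex : LinearMap.ker π ≤ LinearMap.range ι) (hσ : IsDiscreteModule σ) {n : ℕ}
    (hA : IsAcyclic ρ n) (hC : IsAcyclic τ n) : IsAcyclic σ n := by
  intro f hf
  obtain ⟨g, hg⟩ := hC (mapCochains π hπ _ f) (by rw [d_mapCochains, hf, map_zero])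
  obtain ⟨g', rfl⟩ := exists_mapCochains_eq_of_surjective hπ hsurj hσ g
  rw [d_mapCochains] at hg
  obtain ⟨h, hh⟩ := exists_mapCochains_eq_of_forall_mem_range hι hinj (f - d σ n g') (fun x => hex <| by
    have := congrFun (congrArg Subtype.val hg) x
    rw [LinearMap.mem_ker]
    change π (f.1 x - _) = 0
    rw [map_sub, sub_eq_zero]
    exact this.symm)
  obtain ⟨e, rfl⟩ := hA h (mapCochains_injective hι hinj _ (by
    rw [← d_mapCochains, hh, map_sub, hf, d_d, map_zero, sub_zero]))
  refine ⟨g' + mapCochains ι hι n e, ?_⟩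
  rw [map_add, d_mapCochains, hh, add_sub_cancel]

/-- The segment `Hⁿ⁺¹(C) → Hⁿ⁺²(A) → Hⁿ⁺²(B)` of the long exact sequence, with both ends zero. -/
theorem IsAcyclic.succ_of_exact [IsTopologicalGroup G] {ι : A →ₗ[ℤ] B} {π : B →ₗ[ℤ] C}
    (hι : ∀ g a, ι (ρ g a) = σ g (ι a)) (hπ : ∀ g a, π (σ g a) = τ g (π a))
    (hinj : Function.Injective ι) (hsurj : Function.Surjective π)
    (hex : LinearMap.ker π = LinearMap.range ι) (hσ : IsDiscreteModule σ) {n : ℕ}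
    (hB : IsAcyclic σ (n + 1)) (hC : IsAcyclic τ n) : IsAcyclic ρ (n + 1) := by
  intro f hf
  obtain ⟨b, hb⟩ := hB (mapCochains ι hι _ f) (by rw [d_mapCochains, hf, map_zero])
  obtain ⟨e, he⟩ := hC (mapCochains π hπ _ b) (by
    rw [d_mapCochains, hb]
    ext x
    exact LinearMap.mem_ker.1 (hex ▸ LinearMap.mem_range_self ι (f.1 x)))
  obtain ⟨e', rfl⟩ := exists_mapCochains_eq_of_surjective hπ hsurj hσ e
  rw [d_mapCochains] at he
  obtain ⟨h, hh⟩ := exists_mapCochains_eq_of_forall_mem_range hι hinj (b - d σ n e') (fun x => hex ▸ by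
    have := congrFun (congrArg Subtype.val he) x
    rw [LinearMap.mem_ker]
    change π (b.1 x - _) = 0
    rw [map_sub, sub_eq_zero]
    exact this.symm)
  refine ⟨h, mapCochains_injective hι hinj _ ?_⟩
  rw [← d_mapCochains, hh, map_sub, d_d, sub_zero, hb]

/-- Prepending a point `g` is a contracting homotopy that fails only to be equivariant. Summing over
cosets, or passing to coinduced coefficients, repairs this. -/
theorem d_apply_cons {n : ℕ} (f : cochains ρ n) (g : G) (x : Fin (n + 1) → G) :
    (d ρ n f).1 (Fin.cons g x : Fin (n + 2) → G) = f.1 x - ∑ i : Fin (n + 1),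
      (-1 : ℤ) ^ (i : ℕ) • f.1 (Fin.cons g (fun j => x (i.succAbove j)) : Fin (n + 1) → G) := by
  change ∑ i : Fin (n + 2), (-1 : ℤ) ^ (i : ℕ) •
    f.1 (fun j => (Fin.cons g x : Fin (n + 2) → G) (i.succAbove j)) = _
  rw [Fin.sum_univ_succ, sub_eq_add_neg, ← Finset.sum_neg_distrib]
  simp only [Fin.val_zero, pow_zero, one_smul, Fin.zero_succAbove, Fin.cons_succ]
  congr 1
  refine Finset.sum_congr rfl fun i _ => ?_
  rw [Fin.val_succ, pow_succ, mul_neg_one, neg_smul]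
  congr 2
  refine congrArg f.1 (funext fun j => ?_)
  refine Fin.cases ?_ (fun j => ?_) j <;> simp

end Functoriality

/-! ### Uniform local constancy and open subgroups of pro-`p` groups -/

section LocallyConstant

open Filter Topology

/-- The tube lemma: compactness of `X` makes the neighbourhood of `y₀` uniform in `x`. -/
theorem eventually_forall_eq_of_isLocallyConstant {X Y A : Type*} [TopologicalSpace X]
    [TopologicalSpace Y] [CompactSpace X] {Φ : Y × X → A} (hΦ : IsLocallyConstant Φ) (y₀ : Y) :
    ∀ᶠ y in 𝓝 y₀, ∀ x, Φ (y, x) = Φ (y₀, x) := by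
  have h := isCompact_univ.eventually_forall_of_forall_eventually (x₀ := y₀) (K := Set.univ (α := X))
    (P := fun y x => Φ (y, x) = Φ (y₀, x)) (fun x _ => by
      have h₁ : ∀ᶠ z : Y × X in 𝓝 (y₀, x), Φ z = Φ (y₀, x) := hΦ.eventually_eq _
      have h₂ : ∀ᶠ z : Y × X in 𝓝 (y₀, x), Φ (y₀, z.2) = Φ (y₀, x) :=
        (hΦ.comp_continuous (f := fun z : Y × X => (y₀, z.2)) (by fun_prop)).eventually_eq (y₀, x)
      filter_upwards [h₁, h₂] with z hz₁ hz₂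
      exact hz₁.trans hz₂.symm)
  filter_upwards [h] with y hy x using hy x trivial

theorem isLocallyConstant_curry {X Y A : Type*} [TopologicalSpace X]
    [TopologicalSpace Y] [CompactSpace X] {Φ : Y × X → A} (hΦ : IsLocallyConstant Φ) :
    IsLocallyConstant fun y x => Φ (y, x) := by
  rw [IsLocallyConstant.iff_eventually_eq]
  intro y₀
  filter_upwards [eventually_forall_eq_of_isLocallyConstant hΦ y₀] with y hy using funext hy

theorem isLocallyConstant_of_forall_mul_eq {ι G A : Type*} [Finite ι] [Group G]
    [TopologicalSpace G] [IsTopologicalGroup G] {U : Subgroup G} (hU : IsOpen (U : Set G))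
    {f : (ι → G) → A} (hf : ∀ x u : ι → G, (∀ i, u i ∈ U) → f (x * u) = f x) :
    IsLocallyConstant f := by
  rw [IsLocallyConstant.iff_eventually_eq]
  intro x
  have : ∀ᶠ y : ι → G in 𝓝 x, ∀ i, (x i)⁻¹ * y i ∈ U := by
    rw [eventually_all]
    intro i
    have hc : Continuous fun y : ι → G => (x i)⁻¹ * y i := by fun_prop
    exact hc.continuousAt.eventually_mem (hU.mem_nhds (by simp [U.one_mem]))
  filter_upwards [this] with y hy
  rw [← hf x (x⁻¹ * y) hy, mul_inv_cancel_left]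

end LocallyConstant

section ProP

variable {p : ℕ} {G : Type*} [Group G] [TopologicalSpace G]

open Filter Topology

theorem IsProP.exists_openNormal (hG : IsProP p G) {S : Set G} (hS : S ∈ 𝓝 (1 : G)) :
    ∃ U : Subgroup G, U.Normal ∧ IsOpen (U : Set G) ∧ (U : Set G) ⊆ S := by
  have := hG.isTopologicalGroup
  have := hG.compactSpace
  have := hG.totallyDisconnectedSpace
  obtain ⟨V, hVS, hV, hV₁⟩ := mem_nhds_iff.1 hS
  obtain ⟨U, hU⟩ := ProfiniteGrp.exist_openNormalSubgroup_sub_open_nhds_of_one hV hV₁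
  exact ⟨U.toSubgroup, U.isNormal', U.isOpen', hU.trans hVS⟩

theorem IsProP.exists_pow_mem (hG : IsProP p G) {U : Subgroup G} (hU : IsOpen (U : Set G)) (g : G) :
    ∃ k : ℕ, g ^ p ^ k ∈ U := by
  obtain ⟨V, hV, hVo, hVU⟩ := hG.exists_openNormal (hU.mem_nhds U.one_mem)
  obtain ⟨k, hk⟩ := hG.isPGroup_quotient V hVo (g : G ⧸ V)
  exact ⟨k, hVU ((QuotientGroup.eq_one_iff _).1 hk)⟩

theorem IsProP.finiteIndex (hG : IsProP p G) {U : Subgroup G} (hU : IsOpen (U : Set G)) :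
    U.FiniteIndex := by
  have := hG.isTopologicalGroup
  have := hG.compactSpace
  have : Finite (G ⧸ U) := Subgroup.quotient_finite_of_isOpen U hU
  exact Subgroup.finiteIndex_of_finite_quotient

theorem IsProP.exists_index_eq_pow [Fact p.Prime] (hG : IsProP p G) {U : Subgroup G}
    (hU : IsOpen (U : Set G)) : ∃ k : ℕ, U.index = p ^ k := by
  obtain ⟨V, hV, hVo, hVU⟩ := hG.exists_openNormal (hU.mem_nhds U.one_mem)
  have := hG.finiteIndex hVo
  obtain ⟨k, hk⟩ := IsPGroup.iff_card.1 (hG.isPGroup_quotient V hVo)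
  obtain ⟨j, -, hj⟩ := (Nat.dvd_prime_pow Fact.out).1 (hk ▸ Subgroup.index_dvd_of_le hVU :
    U.index ∣ p ^ k)
  exact ⟨j, hj⟩

theorem IsProP.subgroup (hG : IsProP p G) {H : Subgroup G} (hH : IsClosed (H : Set G)) :
    IsProP p H := by
  have := hG.isTopologicalGroup
  have := hG.compactSpace
  have := hG.t2Space
  have := hG.totallyDisconnectedSpace
  refine ⟨inferInstance, isCompact_iff_compactSpace.1 hH.isCompact, inferInstance, inferInstance, ?_⟩
  intro U hU hUo q
  obtain ⟨h, rfl⟩ := QuotientGroup.mk_surjective q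
  obtain ⟨S, hS, hSU⟩ := mem_nhds_subtype _ _ _ |>.1 (hUo.mem_nhds U.one_mem)
  obtain ⟨V, -, hVo, hVS⟩ := hG.exists_openNormal hS
  obtain ⟨k, hk⟩ := hG.exists_pow_mem hVo (h : G)
  exact ⟨k, (QuotientGroup.eq_one_iff _).2 (hSU (hVS hk : ((h ^ p ^ k : H) : G) ∈ S))⟩

/-- Uniform local constancy applied to `(u, x) ↦ f (x * u)` near `u = 1`. -/
theorem IsProP.exists_forall_mul_eq (hG : IsProP p G) {ι A : Type*} [Finite ι] {f : (ι → G) → A}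
    (hf : IsLocallyConstant f) : ∃ U : Subgroup G, U.Normal ∧ IsOpen (U : Set G) ∧
      ∀ x u : ι → G, (∀ i, u i ∈ U) → f (x * u) = f x := by
  have := hG.isTopologicalGroup
  have := hG.compactSpace
  have h := eventually_forall_eq_of_isLocallyConstant
    (hf.comp_continuous (f := fun z : (ι → G) × (ι → G) => z.2 * z.1) (by fun_prop)) 1
  rw [nhds_pi, Filter.eventually_iff, Filter.mem_pi] at h
  obtain ⟨I, -, t, ht, hI⟩ := h
  obtain ⟨U, hU, hUo, hUt⟩ := hG.exists_openNormal (S := ⋂ i, t i) (by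
    rw [Filter.iInter_mem]
    exact ht)
  refine ⟨U, hU, hUo, fun x u hu => ?_⟩
  have := hI (a := u) (fun i _ => Set.mem_iInter.1 (hUt (hu i)) i) x
  simpa using this

end ProP

/-! ### Fixed points of `p`-groups and cohomology killed by powers of `p` -/

section FixedPoints

/-- The image of `G` in the permutations of `A` is a `p`-group, so the number of fixed points is
congruent to `|A|` modulo `p`; Cauchy's theorem then applies to the fixed subgroup. -/
theorem exists_fixed_of_dvd_card {p : ℕ} [Fact p.Prime] {G : Type*} [Group G]
    {A : Type*} [AddCommGroup A] [Finite A] {ρ : Representation ℤ G A}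
    (hρ : ∀ g, ∃ k : ℕ, ρ (g ^ p ^ k) = 1)
    (hp : p ∣ Nat.card A) : ∃ a : A, addOrderOf a = p ∧ ∀ g, ρ g a = a := by
  let : DistribMulAction G A :=
    { smul := fun g a => ρ g a
      one_smul := fun a => by change ρ 1 a = a; simp
      mul_smul := fun g h a => by change ρ (g * h) a = ρ g (ρ h a); simp
      smul_zero := fun g => map_zero (ρ g)
      smul_add := fun g => map_add (ρ g) }
  have hP : IsPGroup p (MulAction.toPermHom G A).range := by
    rintro ⟨_, g, rfl⟩
    obtain ⟨k, hk⟩ := hρ g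
    refine ⟨k, Subtype.ext ?_⟩
    change (MulAction.toPermHom G A g) ^ p ^ k = 1
    rw [← map_pow]
    ext a
    exact congrArg (fun φ : Module.End ℤ A => φ a) hk
  let S : AddSubgroup A := FixedPoints.addSubgroup G A
  have hS : MulAction.fixedPoints (MulAction.toPermHom G A).range A = (S : Set A) := by
    ext a
    constructor
    · exact fun h g => h ⟨_, g, rfl⟩
    · rintro h ⟨_, g, rfl⟩
      exact h g
  have hc : p ∣ Nat.card S := by
    have := hP.card_modEq_card_fixedPoints A
    rw [hS] at this
    exact Nat.modEq_zero_iff_dvd.1 (this.symm.trans (Nat.modEq_zero_iff_dvd.2 hp))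
  obtain ⟨⟨a, ha⟩, h⟩ := exists_prime_addOrderOf_dvd_card' p hc
  exact ⟨a, by rw [← h, ← AddSubgroup.addOrderOf_coe], ha⟩

end FixedPoints

section PTorsion

variable {p : ℕ} {G : Type*} [Group G] [TopologicalSpace G]
  {A : Type*} [AddCommGroup A] {ρ : Representation ℤ G A}

/-- Summing the homotopy `f (g, ·)` over representatives `g` of `G ⧸ U` makes it equivariant, at the
cost of the factor `[G : U]`, a power of `p`. -/
theorem IsProP.exists_d_eq_pow_smul [Fact p.Prime] (hG : IsProP p G) {n : ℕ}
    (f : cochains ρ (n + 1)) (hf : d ρ (n + 1) f = 0) :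
    ∃ (k : ℕ) (e : cochains ρ n), d ρ n e = (p ^ k : ℤ) • f := by
  obtain ⟨U, hU, hUo, hUf⟩ := hG.exists_forall_mul_eq f.2.1
  have := hG.finiteIndex hUo
  have := hG.isTopologicalGroup
  obtain ⟨k, hk⟩ := hG.exists_index_eq_pow hUo
  let : Fintype (G ⧸ U) := Fintype.ofFinite _
  have hcons : ∀ (a b : G) (x : Fin (n + 1) → G), (a : G ⧸ U) = b →
      f.1 (Fin.cons a x : Fin (n + 2) → G) = f.1 (Fin.cons b x : Fin (n + 2) → G) := by
    intro a b x hab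
    rw [← hUf (Fin.cons a x) (Fin.cons (a⁻¹ * b) 1)]
    · refine congrArg f.1 (funext fun i => ?_)
      refine Fin.cases ?_ (fun i => ?_) i <;> simp
    · intro i
      refine Fin.cases ?_ (fun i => ?_) i
      · simpa using QuotientGroup.eq.1 hab
      · simp [U.one_mem]
  let F : (Fin (n + 1) → G) → A := fun x =>
    ∑ q : G ⧸ U, f.1 (Fin.cons q.out x : Fin (n + 2) → G)
  have hF : F = ∑ q : G ⧸ U, fun x => f.1 (Fin.cons q.out x : Fin (n + 2) → G) := by
    ext x; simp [F]
  refine ⟨k, ⟨F, ?_, fun g x => ?_⟩, ?_⟩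
  · rw [hF]
    refine Finset.sum_induction _ IsLocallyConstant (fun _ _ h₁ h₂ => h₁.add h₂)
      (IsLocallyConstant.const 0) fun q _ => ?_
    exact f.2.1.comp_continuous (f := fun x : Fin (n + 1) → G => (Fin.cons q.out x : Fin (n + 2) → G))
      (by fun_prop)
  · simp only [F, map_sum]
    rw [← Equiv.sum_comp (MulAction.toPerm g : Equiv.Perm (G ⧸ U))]
    refine Finset.sum_congr rfl fun q _ => ?_
    rw [← f.2.2, hcons _ (g * q.out)]
    · refine congrArg f.1 (funext fun i => ?_)
      refine Fin.cases ?_ (fun i => ?_) i <;> simp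
    · rw [← smul_eq_mul, MulAction.Quotient.coe_smul_out]
      simp
  · ext x
    have h : ∀ g : G, f.1 x = ∑ i : Fin (n + 2),
        (-1 : ℤ) ^ (i : ℕ) • f.1 (Fin.cons g (fun j => x (i.succAbove j)) : Fin (n + 2) → G) := by
      intro g
      have := d_apply_cons f g x
      rw [hf] at this
      exact (sub_eq_zero.1 this.symm)
    change ∑ i : Fin (n + 2), (-1 : ℤ) ^ (i : ℕ) • F (fun j => x (i.succAbove j)) = (p ^ k : ℤ) • f.1 x
    simp only [F, Finset.smul_sum]
    rw [Finset.sum_comm, Finset.sum_congr rfl fun (q : G ⧸ U) _ => (h q.out).symm, Finset.sum_const,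
      Finset.card_univ, ← Nat.card_eq_fintype_card, ← Subgroup.index, hk]
    simp [← natCast_zsmul]

theorem isAcyclic_of_coprime [Fact p.Prime] (hG : IsProP p G) {N : ℕ} (hN : N.Coprime p)
    (hA : ∀ a : A, N • a = 0) (n : ℕ) : IsAcyclic ρ n := by
  intro f hf
  obtain ⟨k, e, he⟩ := hG.exists_d_eq_pow_smul f hf
  have hNf : (N : ℤ) • f = 0 := by
    ext x
    simpa using hA (f.1 x)
  obtain ⟨a, b, hab⟩ := Nat.isCoprime_iff_coprime.2 (hN.pow_right k)
  refine ⟨b • e, ?_⟩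
  rw [map_smul, he, smul_smul]
  calc _ = (a * N + b * (p ^ k : ℕ) : ℤ) • f := by
        rw [add_smul, mul_smul a, hNf, smul_zero, zero_add, Nat.cast_pow]
    _ = f := by rw [hab, one_smul]

theorem IsProP.exists_pow_eq_one [Finite A] (hG : IsProP p G) (hρ : IsDiscreteModule ρ) (g : G) :
    ∃ k : ℕ, ρ (g ^ p ^ k) = 1 := by
  have h : ∀ᶠ g in nhds (1 : G), ∀ a : A, ρ g a = a := by
    rw [Filter.eventually_all]
    exact fun a => (hρ a).mem_nhds (by simp)
  obtain ⟨U, -, hUo, hU⟩ := hG.exists_openNormal h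
  obtain ⟨k, hk⟩ := hG.exists_pow_mem hUo g
  exact ⟨k, LinearMap.ext (hU hk)⟩

end PTorsion

section Discrete

variable {G : Type*} [Group G] [TopologicalSpace G] {A B : Type*} [AddCommGroup A] [AddCommGroup B]
  {ρ : Representation ℤ G A} {σ : Representation ℤ G B}

theorem isDiscreteModule_of_eventually [IsTopologicalGroup G]
    (h : ∀ a, ∀ᶠ g in nhds (1 : G), ρ g a = a) : IsDiscreteModule ρ := by
  intro a
  rw [isOpen_iff_mem_nhds]
  intro g₀ hg₀
  have hc : Continuous fun g : G => g₀⁻¹ * g := by fun_prop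
  have h' : ∀ᶠ g in nhds (g₀⁻¹ * g₀), ρ g a = a := by simpa using h a
  filter_upwards [hc.continuousAt.eventually h'] with g hg
  have := congrArg (ρ g₀) hg
  rw [← Module.End.mul_apply, ← map_mul, mul_inv_cancel_left] at this
  exact this.trans hg₀

theorem IsDiscreteModule.eventually (hρ : IsDiscreteModule ρ) (a : A) :
    ∀ᶠ g in nhds (1 : G), ρ g a = a :=
  (hρ a).mem_nhds (by simp)

theorem IsDiscreteModule.of_surjective [IsTopologicalGroup G] (hρ : IsDiscreteModule ρ)
    {φ : A →ₗ[ℤ] B} (hφ : ∀ g a, φ (ρ g a) = σ g (φ a)) (hsurj : Function.Surjective φ) :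
    IsDiscreteModule σ :=
  isDiscreteModule_of_eventually fun b => by
    obtain ⟨a, rfl⟩ := hsurj b
    filter_upwards [hρ.eventually a] with g hg
    rw [← hφ, hg]

theorem IsDiscreteModule.of_injective (hσ : IsDiscreteModule σ)
    {φ : A →ₗ[ℤ] B} (hφ : ∀ g a, φ (ρ g a) = σ g (φ a)) (hinj : Function.Injective φ) :
    IsDiscreteModule ρ := fun a => by
  convert hσ (φ a) using 3
  rw [← hφ, hinj.eq_iff]

end Discrete

/-! ### Reduction from torsion modules to `𝔽_p` -/

section Devissage

variable {p : ℕ} {G : Type u} [Group G] [TopologicalSpace G]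

/-- If `p ∣ |A|`, a fixed element of order `p` spans a trivial submodule `𝔽_p`, and induction
handles the quotient. Otherwise `|A|` and a power of `p` both kill the cohomology. -/
theorem isAcyclic_of_finite [Fact p.Prime] (hG : IsProP p G) {n : ℕ}
    (h : IsAcyclic (trivialModule p G) n) {A : Type v} [AddCommGroup A] [Finite A]
    {ρ : Representation ℤ G A} (hρ : IsDiscreteModule ρ) : IsAcyclic ρ n := by
  have := hG.isTopologicalGroup
  induction hN : Nat.card A using Nat.strong_induction_on generalizing A with
  | _ N ih =>
  by_cases hp : p ∣ Nat.card A
  · obtain ⟨a, ha, hfix⟩ := exists_fixed_of_dvd_card (hG.exists_pow_eq_one hρ) hp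
    let ι : ZMod p →ₗ[ℤ] A := (ZMod.lift p ⟨zmultiplesHom A a, by
      simp [← ha, addOrderOf_nsmul_eq_zero]⟩).toIntLinearMap
    have hι : ∀ k : ℤ, ι k = k • a := fun k => by simp [ι]
    have hinv : ∀ g x, ρ g (ι x) = ι x := by
      intro g x
      obtain ⟨k, rfl⟩ := ZMod.intCast_surjective x
      rw [hι, map_zsmul, hfix]
    have hinj : Function.Injective ι := by
      rw [← LinearMap.ker_eq_bot, LinearMap.ker_eq_bot']
      intro x hx
      obtain ⟨k, rfl⟩ := ZMod.intCast_surjective x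
      rw [hι, ← addOrderOf_dvd_iff_zsmul_eq_zero, ha] at hx
      exact (ZMod.intCast_zmod_eq_zero_iff_dvd k p).2 hx
    have hle : ∀ g, LinearMap.range ι ≤ (LinearMap.range ι).comap (ρ g) := by
      rintro g _ ⟨x, rfl⟩
      exact ⟨x, (hinv g x).symm⟩
    have hπ : ∀ g b, (LinearMap.range ι).mkQ (ρ g b) =
        ρ.quotient (LinearMap.range ι) hle g ((LinearMap.range ι).mkQ b) := fun _ _ => rfl
    have : Finite (A ⧸ LinearMap.range ι) := Finite.of_surjective _ (Submodule.mkQ_surjective _)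
    refine IsAcyclic.of_exact (ρ := trivialModule p G) (fun g x => (hinv g x).symm) hπ hinj
      (Submodule.mkQ_surjective _) (Submodule.ker_mkQ _).le hρ h
      (ih _ ?_ (hρ.of_surjective hπ (Submodule.mkQ_surjective _)) rfl)
    have hlt : 1 < Nat.card (LinearMap.range ι) := by
      rw [← Nat.card_congr (LinearEquiv.ofInjective ι hinj).toEquiv, Nat.card_zmod]
      exact (Fact.out : p.Prime).one_lt
    rw [← hN, Submodule.card_eq_card_quotient_mul_card (LinearMap.range ι)]
    exact lt_mul_of_one_lt_left Nat.card_pos hlt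
  · exact isAcyclic_of_coprime hG (((Fact.out : p.Prime).coprime_iff_not_dvd.2 hp).symm)
      (fun a => card_nsmul_eq_zero') n

/-- By compactness a cochain has finitely many values. They span a `G`-stable, finitely generated
torsion group, which is finite. -/
theorem isAcyclic_of_isAddTorsion [Fact p.Prime] (hG : IsProP p G) {n : ℕ}
    (h : IsAcyclic (trivialModule p G) n) {A : Type v} [AddCommGroup A]
    {ρ : Representation ℤ G A} (hρ : IsDiscreteModule ρ) (hA : IsAddTorsion A) :
    IsAcyclic ρ n := by
  have := hG.isTopologicalGroup
  have := hG.compactSpace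
  intro f hf
  let N : Submodule ℤ A := Submodule.span ℤ (Set.range f.1)
  have hle : ∀ g, N ≤ N.comap (ρ g) := by
    intro g
    rw [Submodule.span_le]
    rintro _ ⟨x, rfl⟩
    change ρ g (f.1 x) ∈ N
    rw [← f.2.2]
    exact Submodule.subset_span ⟨_, rfl⟩
  have hfin : Module.Finite ℤ N := Module.Finite.span_of_finite ℤ f.2.1.range_finite
  have : Finite N := Module.finite_of_fg_torsion N fun a => by
    obtain ⟨k, hk, hka⟩ := (hA (a : A)).exists_nsmul_eq_zero
    exact ⟨⟨k, by simpa using hk.ne'⟩, Subtype.ext (by simpa using hka)⟩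
  have hι : ∀ g a, N.subtype (ρ.subrepresentation N hle g a) = ρ g (N.subtype a) := fun _ _ => rfl
  obtain ⟨f', hf'⟩ := exists_mapCochains_eq_of_forall_mem_range hι N.injective_subtype f (fun x => by
    rw [Submodule.range_subtype]
    exact Submodule.subset_span ⟨x, rfl⟩)
  obtain ⟨e, rfl⟩ := isAcyclic_of_finite hG h (hρ.of_injective hι N.injective_subtype) f'
    (mapCochains_injective hι N.injective_subtype _ (by rw [← d_mapCochains, hf', hf, map_zero]))
  exact ⟨mapCochains _ hι _ e, by rw [d_mapCochains, hf']⟩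

end Devissage

/-! ### Coinduced modules and dimension shifting -/

section Coinduced

variable {G : Type u} [Group G] [TopologicalSpace G] [IsTopologicalGroup G]
  {A : Type v} [AddCommGroup A] (ρ : Representation ℤ G A)

/-- The coinduced module of locally constant functions `φ : G → A`, with the action
`(g φ)(y) = g φ (g⁻¹ y)`. -/
def coinduced : Representation ℤ G (LocallyConstant G A) where
  toFun g :=
    { toFun := fun φ => ⟨fun y => ρ g (φ (g⁻¹ * y)),
        (φ.isLocallyConstant.comp_continuous (f := fun y => g⁻¹ * y) (by fun_prop)).comp (ρ g)⟩
      map_add' := fun φ ψ => by ext y; simp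
      map_smul' := fun c φ => by ext y; simp }
  map_one' := by ext φ y; simp
  map_mul' g h := by ext φ y; simp [mul_assoc]

variable {ρ}

theorem isLocallyConstant_apply (hρ : IsDiscreteModule ρ) {X : Type*} [TopologicalSpace X] {a : X → G} {b : X → A}
    (ha : Continuous a) (hb : IsLocallyConstant b) : IsLocallyConstant fun x => ρ (a x) (b x) := by
  rw [IsLocallyConstant.iff_eventually_eq]
  intro x
  have hc : Continuous fun y => (a x)⁻¹ * a y := by fun_prop
  have h := hc.continuousAt (x := x) |>.eventually_mem
    ((hρ (b x)).mem_nhds (by simp : (a x)⁻¹ * a x ∈ {g | ρ g (b x) = b x}))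
  filter_upwards [h, hb.eventually_eq x] with y hy hby
  have := congrArg (ρ (a x)) hy
  rw [← Module.End.mul_apply, ← map_mul, mul_inv_cancel_left] at this
  rw [hby, this]

theorem isDiscreteModule_coinduced [CompactSpace G] (hρ : IsDiscreteModule ρ) :
    IsDiscreteModule (coinduced ρ) :=
  isDiscreteModule_of_eventually fun φ => by
    have h : IsLocallyConstant fun z : G × G => ρ z.1 (φ (z.1⁻¹ * z.2)) :=
      isLocallyConstant_apply hρ continuous_fst
        (φ.isLocallyConstant.comp_continuous (f := fun z : G × G => z.1⁻¹ * z.2) (by fun_prop))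
    filter_upwards [eventually_forall_eq_of_isLocallyConstant h 1] with g hg
    ext y
    have := hg y
    simp only [map_one, inv_one, one_mul] at this
    exact this

theorem isAcyclic_coinduced [CompactSpace G] (n : ℕ) : IsAcyclic (coinduced ρ) n := by
  intro f hf
  -- The prepended point is also the evaluation point, so `G` moves both together and the homotopy
  -- is equivariant.
  let E : (Fin (n + 1) → G) × G → A := fun z => f.1 (Fin.cons z.2 z.1 : Fin (n + 2) → G) z.2
  have hE : IsLocallyConstant E := by
    have h₁ : IsLocallyConstant fun z : (Fin (n + 1) → G) × G => f.1 (Fin.cons z.2 z.1 : Fin (n + 2) → G) :=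
      f.2.1.comp_continuous (f := fun z : (Fin (n + 1) → G) × G => (Fin.cons z.2 z.1 : Fin (n + 2) → G))
        (by fun_prop)
    rw [IsLocallyConstant.iff_eventually_eq]
    intro z
    filter_upwards [h₁.eventually_eq z, ((f.1 (Fin.cons z.2 z.1 : Fin (n + 2) → G)).isLocallyConstant.comp_continuous
      (continuous_snd (X := Fin (n + 1) → G))).eventually_eq z] with w hw hw'
    simp only [E]
    rw [hw]
    exact hw'
  let e : (Fin (n + 1) → G) → LocallyConstant G A := fun x =>
    ⟨fun y => E (x, y), hE.comp_continuous (f := fun y => (x, y)) (by fun_prop)⟩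
  refine ⟨⟨e, ?_, fun g x => ?_⟩, ?_⟩
  · exact IsLocallyConstant.desc e (fun φ : LocallyConstant G A => (φ : G → A))
      (isLocallyConstant_curry hE) LocallyConstant.coe_injective
  · ext y
    change f.1 (Fin.cons y fun i => g * x i : Fin (n + 2) → G) y =
      ρ g (f.1 (Fin.cons (g⁻¹ * y) x : Fin (n + 2) → G) (g⁻¹ * y))
    have := congrArg (fun φ : LocallyConstant G A => φ y)
      (f.2.2 g (Fin.cons (g⁻¹ * y) x : Fin (n + 2) → G))
    refine Eq.trans ?_ this
    refine congrArg (fun z => f.1 z y) (funext fun i => ?_)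
    refine Fin.cases ?_ (fun i => ?_) i <;> simp
  · ext x y
    have h := d_apply_cons f y x
    rw [hf] at h
    have h' := congrArg (fun φ : LocallyConstant G A => φ y) (sub_eq_zero.1 h.symm)
    refine Eq.trans ?_ h'.symm
    change (∑ i : Fin (n + 2), (-1 : ℤ) ^ (i : ℕ) • e (fun j => x (i.succAbove j))) y = _
    have hs : ∀ F : Fin (n + 2) → LocallyConstant G A, (∑ i, F i) y = ∑ i, F i y := fun F =>
      map_sum (⟨⟨fun φ => φ y, rfl⟩, fun _ _ => rfl⟩ : LocallyConstant G A →+ A) F _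
    rw [hs, hs]
    rfl

end Coinduced

section DimensionShift

variable {p : ℕ} {G : Type u} [Group G] [TopologicalSpace G]

/-- Embed `A` in its coinduced module as the constants and shift to the quotient. The universe `max
u v` contains functions on `G`, so the quotient is again covered by the induction. -/
theorem isAcyclic_add [Fact p.Prime] (hG : IsProP p G) {n : ℕ}
    (h : IsAcyclic (trivialModule p G) n) (k : ℕ) {A : Type max u v} [AddCommGroup A]
    {ρ : Representation ℤ G A} (hρ : IsDiscreteModule ρ) (hA : IsAddTorsion A) :
    IsAcyclic ρ (n + k) := by
  have := hG.isTopologicalGroup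
  have := hG.compactSpace
  induction k generalizing A with
  | zero => exact isAcyclic_of_isAddTorsion hG h hρ hA
  | succ k ih =>
    let ι : A →ₗ[ℤ] LocallyConstant G A :=
      { toFun := fun a => LocallyConstant.const G a
        map_add' := fun _ _ => rfl
        map_smul' := fun _ _ => rfl }
    have hι : ∀ g a, ι (ρ g a) = coinduced ρ g (ι a) := fun _ _ => rfl
    have hinj : Function.Injective ι := fun a b hab =>
      congrArg (fun φ : LocallyConstant G A => φ 1) hab
    have hle : ∀ g, LinearMap.range ι ≤ (LinearMap.range ι).comap (coinduced ρ g) := by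
      rintro g _ ⟨a, rfl⟩
      exact ⟨ρ g a, hι g a⟩
    have hπ : ∀ g φ, (LinearMap.range ι).mkQ (coinduced ρ g φ) =
        (coinduced ρ).quotient (LinearMap.range ι) hle g ((LinearMap.range ι).mkQ φ) :=
      fun _ _ => rfl
    have htor : IsAddTorsion (LocallyConstant G A) := by
      intro φ
      rw [isOfFinAddOrder_iff_nsmul_eq_zero]
      choose N hN hNa using fun a : A => (hA a).exists_nsmul_eq_zero
      refine ⟨∏ a ∈ φ.range_finite.toFinset, N a, Finset.prod_pos fun a _ => hN a, ?_⟩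
      ext y
      obtain ⟨c, hc⟩ := Finset.dvd_prod_of_mem N
        (φ.range_finite.mem_toFinset.2 (Set.mem_range_self y))
      change (∏ a ∈ φ.range_finite.toFinset, N a) • φ y = 0
      rw [hc, mul_comm, mul_smul, hNa, smul_zero]
    refine IsAcyclic.succ_of_exact hι hπ hinj (Submodule.mkQ_surjective _) (Submodule.ker_mkQ _)
      (isDiscreteModule_coinduced hρ) (isAcyclic_coinduced _) ?_
    exact ih ((isDiscreteModule_coinduced hρ).of_surjective hπ (Submodule.mkQ_surjective _))
      (htor.of_surjective (f := (LinearMap.range ι).mkQ.toAddMonoidHom)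
        (Submodule.mkQ_surjective _))

end DimensionShift

/-! ### Linear algebra over `𝔽_p` and invariant forms -/

section LinearAlgebra

variable {p : ℕ} [Fact p.Prime]

/-- In the dual of a finite space every subspace is the annihilator of its coannihilator. No
finiteness of `Y` is needed, so `Y` can be a group of cocycles. -/
theorem exists_apply_eq_of_forall_ker {X Y : Type*} [AddCommGroup X] [AddCommGroup Y]
    [Finite X] [Module (ZMod p) X] (P : Y →ₗ[ℤ] X →ₗ[ℤ] ZMod p) (L : X →ₗ[ℤ] ZMod p)
    (h : ∀ x, (∀ y, P y x = 0) → L x = 0) : ∃ y, P y = L := by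
  have : Module.Finite (ZMod p) X := Module.Finite.of_finite
  let T : (X →ₗ[ℤ] ZMod p) →+ Module.Dual (ZMod p) X :=
    AddMonoidHom.mk' (fun φ => φ.toAddMonoidHom.toZModLinearMap p) fun φ ψ => by
      refine LinearMap.ext fun x => ?_
      rw [LinearMap.add_apply]
      rfl
  let W : Subspace (ZMod p) (Module.Dual (ZMod p) X) :=
    AddSubgroup.toZModSubmodule p (T.comp P.toAddMonoidHom).range
  have hL : T L ∈ W := by
    rw [← Subspace.dualCoannihilator_dualAnnihilator_eq (W := W), Submodule.mem_dualAnnihilator]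
    intro x hx
    rw [Submodule.mem_dualCoannihilator] at hx
    exact h x fun y => hx _ ⟨y, rfl⟩
  obtain ⟨y, hy⟩ := hL
  exact ⟨y, LinearMap.ext fun x => congrArg (fun φ : Module.Dual (ZMod p) X => φ x) hy⟩

theorem exists_linearMap_ne_zero {A : Type*} [AddCommGroup A] [Nontrivial A]
    [Module (ZMod p) A] : ∃ φ : A →ₗ[ℤ] ZMod p, φ ≠ 0 := by
  obtain ⟨a, ha⟩ := exists_ne (0 : A)
  by_contra! h
  have key := Module.forall_dual_apply_eq_zero_iff (V := A) (ZMod p) a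
  refine ha (key.1 fun φ => ?_)
  exact congrArg (fun ψ : A →ₗ[ℤ] ZMod p => ψ a) (h φ.toAddMonoidHom.toIntLinearMap)

/-- Scalar multiplication of an `𝔽_p`-vector space as a biadditive map. -/
def smulBilin (p : ℕ) (A : Type*) [AddCommGroup A] [Module (ZMod p) A] :
    ZMod p →ₗ[ℤ] A →ₗ[ℤ] A :=
  LinearMap.mk₂ ℤ (fun c a => c • a) add_smul smul_assoc smul_add
    fun k c a => (smul_comm k c a).symm

end LinearAlgebra

section InvariantForms

variable (p : ℕ) {G : Type*} [Group G]
  {A : Type*} [AddCommGroup A] (ρ : Representation ℤ G A)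

/-- The group `Hom_G(A, 𝔽_p)`. -/
def invariantForms : Submodule ℤ (A →ₗ[ℤ] ZMod p) where
  carrier := {θ | ∀ g a, θ (ρ g a) = θ a}
  add_mem' := fun h h' g a => by simp [h g a, h' g a]
  zero_mem' := fun _ _ => rfl
  smul_mem' := fun c θ h g a => by simp [h g a]

variable {p ρ}

theorem map_eq_of_mem_invariantForms {θ : A →ₗ[ℤ] ZMod p} (hθ : θ ∈ invariantForms p ρ) (g : G)
    (a : A) : θ (ρ g a) = Representation.trivial ℤ G (ZMod p) g (θ a) :=
  hθ g a

/-- The fixed-point lemma applied to the dual of `A`, a nonzero finite `p`-torsion group. -/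
theorem exists_invariantForms_ne_zero [Fact p.Prime] [Finite A] [Nontrivial A]
    (hA : ∀ a : A, p • a = 0) (hρ : ∀ g, ∃ k : ℕ, ρ (g ^ p ^ k) = 1) :
    ∃ θ ∈ invariantForms p ρ, θ ≠ 0 := by
  have : Finite (A →ₗ[ℤ] ZMod p) := Finite.of_injective _ DFunLike.coe_injective
  let : Module (ZMod p) A := AddCommGroup.zmodModule hA
  obtain ⟨φ, hφ⟩ := exists_linearMap_ne_zero (p := p) (A := A)
  have hcard : p ∣ Nat.card (A →ₗ[ℤ] ZMod p) := by
    have := addOrderOf_dvd_natCard φ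
    rwa [addOrderOf_eq_prime (p := p) (by ext; simp) hφ] at this
  obtain ⟨θ, hθ, hinv⟩ := exists_fixed_of_dvd_card (ρ := ρ.linHom (Representation.trivial ℤ G (ZMod p)))
    (fun g => by
      obtain ⟨k, hk⟩ := hρ g⁻¹
      refine ⟨k, ?_⟩
      ext ψ a
      have := congrArg (fun φ : Module.End ℤ A => φ a) hk
      simp only [Representation.linHom_apply, ← inv_pow]
      simpa using congrArg ψ this) hcard
  refine ⟨θ, fun g a => ?_, ?_⟩
  · have := congrArg (fun ψ : A →ₗ[ℤ] ZMod p => ψ (ρ g a)) (hinv g)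
    simpa [Representation.linHom_apply] using this.symm
  · rintro rfl
    rw [addOrderOf_zero] at hθ
    exact (Fact.out : p.Prime).one_lt.ne hθ

variable [TopologicalSpace G]

/-- The cocycles `θ ∘ f`, for a fixed cocycle `f` and varying `θ : Hom_G(A, 𝔽_p)`. -/
def evalCocycle {n : ℕ} (f : cocycles ρ n) :
    invariantForms p ρ →ₗ[ℤ] cocycles (trivialModule p G) n where
  toFun θ := ⟨mapCochains θ.1 (map_eq_of_mem_invariantForms θ.2) n f.1, by
    rw [cocycles, LinearMap.mem_ker, d_mapCochains, LinearMap.mem_ker.1 f.2, map_zero]⟩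
  map_add' _ _ := rfl
  map_smul' _ _ := rfl

theorem d_trivialModule_zero (f : cochains (trivialModule p G) 0) : d (trivialModule p G) 0 f = 0 := by
  have h : ∀ x y : Fin 1 → G, f.1 x = f.1 y := by
    intro x y
    have := f.2.2 (x 0 * (y 0)⁻¹) y
    rw [Representation.trivial_apply] at this
    rw [← this]
    refine congrArg f.1 (funext fun i => ?_)
    rw [Subsingleton.elim i 0, inv_mul_cancel_right]
  ext x
  change ∑ i : Fin 2, (-1 : ℤ) ^ (i : ℕ) • f.1 (fun j => x (i.succAbove j)) = 0
  rw [Fin.sum_univ_two, h _ fun j => x (Fin.succAbove 1 j)]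
  simp

end InvariantForms

/-! ### Duality in top degree for finite coefficients -/

section Duality

theorem mul_trivial (p : ℕ) {G : Type*} [Group G] (g : G) (a b : ZMod p) :
    LinearMap.mul ℤ (ZMod p) (Representation.trivial ℤ G (ZMod p) g a) (Representation.trivial ℤ G (ZMod p) g b) =
      Representation.trivial ℤ G (ZMod p) g (LinearMap.mul ℤ (ZMod p) a b) :=
  rfl

variable {p m : ℕ} {G : Type u} [Group G] [TopologicalSpace G]

/-- By nondegeneracy, an `x` with `y ∪ E x` trivial for all `y` has `E x` trivial, so `L x` is
trivial by hypothesis. The functional `L` is therefore cupping with some `b`. -/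
theorem IsGPD.exists_cup_sub_mem [Fact p.Prime] (hG : IsGPD p (m + 1) G) {X : Type*} [AddCommGroup X]
    [Finite X] (hX : ∀ x : X, p • x = 0) (E : X →ₗ[ℤ] cocycles (trivialModule p G) 1)
    (L : X →ₗ[ℤ] cocycles (trivialModule p G) (m + 1))
    (h : ∀ x, (E x).1 ∈ coboundaries (trivialModule p G) 1 → (L x).1 ∈ coboundaries (trivialModule p G) (m + 1)) :
    ∃ b : cocycles (trivialModule p G) m, ∀ x,
      (L x).1 - cupCochains (LinearMap.mul ℤ (ZMod p)) (mul_trivial p)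
        rfl b.1 (E x).1 ∈ coboundaries (trivialModule p G) (m + 1) := by
  let : Module (ZMod p) X := AddCommGroup.zmodModule hX
  obtain ⟨t⟩ := hG.top_cohomology
  let tr : cocycles (trivialModule p G) (m + 1) →ₗ[ℤ] ZMod p :=
    t.toAddMonoidHom.toIntLinearMap ∘ₗ Submodule.mkQ _
  have htr : ∀ f, tr f = 0 ↔ f.1 ∈ coboundaries (trivialModule p G) (m + 1) := by
    intro f
    refine (map_eq_zero_iff t t.injective).trans ?_
    exact Submodule.Quotient.mk_eq_zero _
  let P := ((cupCocycles (LinearMap.mul ℤ (ZMod p)) (mul_trivial (G := G) p)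
    (rfl : m + 1 = m + 1)).compl₂ E).compr₂ tr
  have hP : ∀ x, (∀ y, P y x = 0) → (E x).1 ∈ coboundaries (trivialModule p G) 1 := by
    intro x hx
    have hq := (hG.nondegenerate m 1 rfl).2 (Submodule.Quotient.mk (E x)) fun y => by
      obtain ⟨y, rfl⟩ := Submodule.Quotient.mk_surjective _ y
      exact (Submodule.Quotient.mk_eq_zero _).2 ((htr _).1 (hx y))
    have hmem : E x ∈ (coboundaries (trivialModule p G) 1).submoduleOf (cocycles _ 1) :=
      (Submodule.Quotient.mk_eq_zero _).1 hq
    exact hmem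
  obtain ⟨b, hb⟩ := exists_apply_eq_of_forall_ker P (tr ∘ₗ L) fun x hx => (htr _).2 (h x (hP x hx))
  refine ⟨b, fun x => ?_⟩
  have := congrArg (fun φ : X →ₗ[ℤ] ZMod p => φ x) hb.symm
  rw [← sub_eq_zero] at this
  exact (htr (L x - cupCocycles (LinearMap.mul ℤ (ZMod p)) (mul_trivial p) rfl b (E x))).1
    ((map_sub tr _ _).trans this)

/-- The inductive step: the lift of `f` to `B` is corrected by the connecting map `H^m(G, 𝔽_p) →
H^{m+1}(G, B)`, which up to sign is the cup product with the extension class `e`. -/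
theorem IsGPD.mem_coboundaries_of_exact [Fact p.Prime] (hG : IsGPD p (m + 1) G)
    {A B : Type*} [AddCommGroup A] [AddCommGroup B] [Module (ZMod p) A] [Module (ZMod p) B] [Finite B]
    {ρ : Representation ℤ G A} {σ : Representation ℤ G B} (hρ : IsDiscreteModule ρ)
    {ι : B →ₗ[ℤ] A} (hι : ∀ g b, ι (σ g b) = ρ g (ι b)) (hinj : Function.Injective ι)
    {θ₀ : A →ₗ[ℤ] ZMod p} (hθ₀ : θ₀ ∈ invariantForms p ρ) (hex : LinearMap.ker θ₀ = LinearMap.range ι)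
    {m₀ : A} (hm₀ : θ₀ m₀ = 1)
    (hσ : ∀ f : cocycles σ (m + 1), (∀ θ : invariantForms p σ,
      (evalCocycle f θ).1 ∈ coboundaries (trivialModule p G) (m + 1)) → f.1 ∈ coboundaries σ (m + 1))
    (f : cocycles ρ (m + 1))
    (hf : ∀ θ : invariantForms p ρ, (evalCocycle f θ).1 ∈ coboundaries (trivialModule p G) (m + 1)) :
    f.1 ∈ coboundaries ρ (m + 1) := by
  have := hG.isProP.isTopologicalGroup
  have hdf : d ρ (m + 1) f.1 = 0 := f.2
  -- modify `f` by a coboundary so that it takes values in `B`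
  obtain ⟨g, hg⟩ := hf ⟨θ₀, hθ₀⟩
  obtain ⟨g, rfl⟩ := exists_mapCochains_eq_of_surjective (map_eq_of_mem_invariantForms hθ₀)
    (fun c => ⟨c • m₀, by rw [ZMod.map_smul, hm₀, smul_eq_mul, mul_one]⟩) hρ g
  rw [d_mapCochains] at hg
  obtain ⟨c, hc⟩ := exists_mapCochains_eq_of_forall_mem_range hι hinj (f.1 - d ρ m g) (fun x => by
    rw [← hex, LinearMap.mem_ker]
    change θ₀ (f.1.1 x - _) = 0
    rw [map_sub, sub_eq_zero]
    exact (congrFun (congrArg Subtype.val hg) x).symm)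
  have hdc : c ∈ cocycles σ (m + 1) := mapCochains_injective hι hinj _ (by
    rw [← d_mapCochains, hc, map_sub, hdf, d_d, map_zero, sub_zero])
  -- the extension class of `0 → B → A → 𝔽_p → 0`
  let μ : cochains ρ 0 := ⟨fun x => ρ (x 0) m₀,
    isLocallyConstant_apply hρ (continuous_apply 0) (IsLocallyConstant.const m₀),
    fun g x => by simp⟩
  have hdμ : ∀ x : Fin 2 → G, (d ρ 0 μ).1 x = ρ (x 1) m₀ - ρ (x 0) m₀ := by
    intro x
    change ∑ i : Fin 2, (-1 : ℤ) ^ (i : ℕ) • ρ (x (i.succAbove 0)) m₀ = _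
    rw [Fin.sum_univ_two]
    simp [sub_eq_add_neg]
  obtain ⟨e, he⟩ := exists_mapCochains_eq_of_forall_mem_range hι hinj (d ρ 0 μ) (fun x => by
    rw [← hex, LinearMap.mem_ker, hdμ, map_sub, hθ₀, hθ₀, sub_self])
  have hde : e ∈ cocycles σ 1 := mapCochains_injective hι hinj _ (by
    rw [← d_mapCochains, he, d_d, map_zero])
  have hfin : Finite (B →ₗ[ℤ] ZMod p) := Finite.of_injective _ DFunLike.coe_injective
  obtain ⟨b, hb⟩ := hG.exists_cup_sub_mem (X := invariantForms p σ)
    (fun θ => by ext; simp) (evalCocycle ⟨e, hde⟩) (evalCocycle ⟨c, hdc⟩) (by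
      rintro ⟨θ', hθ'⟩ ⟨k, hk⟩
      -- With trivial coefficients the only 1-coboundary is zero, so `θ' ∘ e` vanishes identically.
      have hθe : ∀ g, θ' (e.1 ![1, g]) = 0 := fun g => by
        rw [d_trivialModule_zero] at hk
        exact (congrFun (congrArg Subtype.val hk) ![1, g]).symm
      have heg : ∀ g, ι (e.1 ![1, g]) = ρ g m₀ - m₀ := fun g => by
        have := (congrFun (congrArg Subtype.val he) ![1, g]).trans (hdμ _)
        rwa [Matrix.cons_val_zero, Matrix.cons_val_one, map_one] at this
      -- Projection to `B` along `m₀`. Its failure to be equivariant is measured by `e`, which `θ'`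
      -- kills; hence `θ' ∘ π` is an invariant form extending `θ'` to `A`.
      obtain ⟨π, hπ⟩ : ∃ π : A →ₗ[ℤ] B, ∀ a, ι (π a) = a - θ₀ a • m₀ := by
        have h : ∀ a, ∃ b, ι b = a - θ₀ a • m₀ := fun a => by
          change _ ∈ LinearMap.range ι
          rw [← hex, LinearMap.mem_ker, map_sub, ZMod.map_smul, hm₀, smul_eq_mul, mul_one, sub_self]
        choose π hπ using h
        refine ⟨(AddMonoidHom.mk' π fun a a' => hinj ?_).toIntLinearMap, hπ⟩
        rw [map_add, hπ, hπ, hπ, map_add, add_smul]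
        abel
      have hπι : ∀ b, π (ι b) = b := fun b => hinj (by
        have : θ₀ (ι b) = 0 := by
          rw [← LinearMap.mem_ker, hex]
          exact ⟨b, rfl⟩
        rw [hπ, this, zero_smul, sub_zero])
      have hθ : θ' ∘ₗ π ∈ invariantForms p ρ := by
        intro g a
        have : π (ρ g a) = σ g (π a) + θ₀ a • e.1 ![1, g] := hinj (by
          rw [map_add, hι, ZMod.map_smul, heg, hπ, hπ, hθ₀, map_sub, ZMod.map_smul (ρ g), smul_sub]
          abel)
        change θ' (π (ρ g a)) = θ' (π a)
        rw [this, map_add, hθ', ZMod.map_smul, hθe, smul_zero, add_zero]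
      have : (evalCocycle ⟨c, hdc⟩ ⟨θ', hθ'⟩).1 = (evalCocycle f ⟨_, hθ⟩).1 -
          d (trivialModule p G) m (mapCochains _ (map_eq_of_mem_invariantForms hθ) m g) := by
        rw [d_mapCochains]
        change _ = mapCochains (θ' ∘ₗ π) (map_eq_of_mem_invariantForms hθ) _ f.1 - _
        rw [← map_sub, ← hc]
        ext x
        exact congrArg θ' (hπι _).symm
      rw [this]
      exact sub_mem (hf _) ⟨_, rfl⟩)
  have hβ : ∀ (g : G) (c : ZMod p) (b : B),
      smulBilin p B (trivialModule p G g c) (σ g b) = σ g (smulBilin p B c b) :=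
    fun g c b => (ZMod.map_smul (σ g) c b).symm
  have hβ' : ∀ (g : G) (c : ZMod p) (a : A),
      smulBilin p A (trivialModule p G g c) (ρ g a) = ρ g (smulBilin p A c a) :=
    fun g c a => (ZMod.map_smul (ρ g) c a).symm
  obtain ⟨h, hh⟩ := hσ (⟨c, hdc⟩ - cupCocycles (smulBilin p B) hβ rfl b ⟨e, hde⟩) (fun θ => by
    refine Eq.mp (congrArg (· ∈ _) ?_) (hb θ)
    ext x
    change θ.1 (c.1 x) - b.1.1 _ * θ.1 (e.1 _) = θ.1 (c.1 x - b.1.1 _ • e.1 _)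
    rw [map_sub, ZMod.map_smul]
    rfl)
  -- In `A` the class `e` becomes `d μ`, so the correction `b ∪ e` becomes a coboundary there.
  have hcup : cupCochains (smulBilin p A) hβ' rfl b.1 (d ρ 0 μ) =
      (-1 : ℤ) ^ m • d ρ m (cupCochains (smulBilin p A) hβ' (rfl : m + 0 = m) b.1 μ) := by
    rw [d_cup, LinearMap.mem_ker.1 b.2]
    simp [smul_smul, ← mul_pow]
  have hcup' : mapCochains ι hι (m + 1) (cupCochains (smulBilin p B) hβ rfl b.1 e) =
      cupCochains (smulBilin p A) hβ' rfl b.1 (mapCochains ι hι 1 e) :=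
    Subtype.ext (funext fun x => ZMod.map_smul ι _ _)
  refine ⟨g + mapCochains ι hι m h +
    (-1 : ℤ) ^ m • cupCochains (smulBilin p A) hβ' (rfl : m + 0 = m) b.1 μ, ?_⟩
  have hh' : d σ m h = c - cupCochains (smulBilin p B) hβ rfl b.1 e := hh
  rw [map_add, map_add, map_smul, ← hcup, d_mapCochains, hh', map_sub, hc, hcup', he]
  abel

theorem IsGPD.mem_coboundaries [Fact p.Prime] (hG : IsGPD p (m + 1) G) {A : Type v} [AddCommGroup A]
    [Finite A] (hA : ∀ a : A, p • a = 0) {ρ : Representation ℤ G A} (hρ : IsDiscreteModule ρ)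
    (f : cocycles ρ (m + 1))
    (hf : ∀ θ : invariantForms p ρ, (evalCocycle f θ).1 ∈ coboundaries (trivialModule p G) (m + 1)) :
    f.1 ∈ coboundaries ρ (m + 1) := by
  induction hN : Nat.card A using Nat.strong_induction_on generalizing A with
  | _ N ih =>
  rcases subsingleton_or_nontrivial A with hA' | hA'
  · have : f.1 = 0 := Subtype.ext (funext fun x => Subsingleton.elim _ _)
    rw [this]
    exact zero_mem _
  obtain ⟨θ₀, hθ₀, hne⟩ := exists_invariantForms_ne_zero hA (hG.isProP.exists_pow_eq_one hρ)
  let : Module (ZMod p) A := AddCommGroup.zmodModule hA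
  obtain ⟨m₀, hm₀⟩ : ∃ m₀, θ₀ m₀ = 1 := by
    obtain ⟨a, ha⟩ := DFunLike.ne_iff.1 hne
    exact ⟨(θ₀ a)⁻¹ • a, by rw [ZMod.map_smul]; exact inv_mul_cancel₀ ha⟩
  let K : Submodule ℤ A := LinearMap.ker θ₀
  have hK : ∀ g, K ≤ K.comap (ρ g) := fun g a ha => (hθ₀ g a).trans ha
  have hι : ∀ g a, K.subtype (ρ.subrepresentation K hK g a) = ρ g (K.subtype a) := fun _ _ => rfl
  have hKp : ∀ a : K, p • a = 0 := fun a => Subtype.ext (hA a)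
  let : Module (ZMod p) K := AddCommGroup.zmodModule hKp
  have hlt : Nat.card K < N := by
    rw [← hN]
    refine Finite.card_subtype_lt (x := m₀) ?_
    change ¬ θ₀ m₀ = 0
    rw [hm₀]
    exact one_ne_zero
  exact hG.mem_coboundaries_of_exact (B := K) hρ hι K.injective_subtype hθ₀ K.range_subtype.symm hm₀
    (fun f' hf' => ih _ hlt hKp (hρ.of_injective hι K.injective_subtype) f' hf' rfl) f hf

end Duality

/-! ### Permutation modules and extension of cochains from `H` to `G` -/

section Permutation

variable (p : ℕ) {G : Type*} [Group G]

/-- The permutation module of functions `G ⧸ U → 𝔽_p`, with `(g φ)(q) = φ (g⁻¹ q)`. -/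
def permModule (U : Subgroup G) : Representation ℤ G (G ⧸ U → ZMod p) where
  toFun g := LinearMap.funLeft ℤ (ZMod p) (fun q => g⁻¹ • q)
  map_one' := by ext φ q; simp [LinearMap.funLeft_apply]
  map_mul' g h := by
    refine LinearMap.ext fun φ => funext fun q => ?_
    simp [LinearMap.funLeft_apply, mul_smul]

variable {p}

theorem permModule_apply (U : Subgroup G) (g : G) (φ : G ⧸ U → ZMod p) (q : G ⧸ U) :
    permModule p U g φ q = φ (g⁻¹ • q) :=
  rfl

theorem isDiscreteModule_permModule [TopologicalSpace G] (hG : IsProP p G) {U : Subgroup G}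
    (hU : IsOpen (U : Set G)) : IsDiscreteModule (permModule p U) := by
  have := hG.isTopologicalGroup
  obtain ⟨W, hW, hWo, hWU⟩ := hG.exists_openNormal (hU.mem_nhds U.one_mem)
  refine isDiscreteModule_of_eventually fun φ => ?_
  filter_upwards [hWo.mem_nhds W.one_mem] with w hw
  funext q
  obtain ⟨y, rfl⟩ := QuotientGroup.mk_surjective q
  rw [permModule_apply]
  congr 1
  refine QuotientGroup.eq.2 (hWU ?_)
  have := hW.conj_mem w hw y⁻¹
  simpa [mul_assoc] using this

/-- The inclusion of `𝔽_p`-valued functions on `G ⧸ U` into those on `G ⧸ V`, for `V ≤ U`. -/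
def permModuleMap (p : ℕ) {U V : Subgroup G} (h : V ≤ U) : (G ⧸ U → ZMod p) →ₗ[ℤ] (G ⧸ V → ZMod p) :=
  LinearMap.funLeft ℤ (ZMod p) (Subgroup.quotientMapOfLE h)

theorem permModuleMap_equivariant {U V : Subgroup G} (h : V ≤ U) (g : G) (φ : G ⧸ U → ZMod p) :
    permModuleMap p h (permModule p U g φ) = permModule p V g (permModuleMap p h φ) := by
  funext q
  obtain ⟨y, rfl⟩ := QuotientGroup.mk_surjective q
  rfl

/-- By transitivity `θ` is a multiple of the sum over `G ⧸ V`, and a function pulled back from `G ⧸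
U` is constant on fibres of size `[U : V]`, divisible by `p`. -/
theorem invariantForms_permModuleMap_eq_zero {U V : Subgroup G} (h : V ≤ U) [V.FiniteIndex]
    (hp : p ∣ V.relIndex U) {θ : (G ⧸ V → ZMod p) →ₗ[ℤ] ZMod p}
    (hθ : θ ∈ invariantForms p (permModule p V)) (φ : G ⧸ U → ZMod p) :
    θ (permModuleMap p h φ) = 0 := by
  classical
  have : U.FiniteIndex := Subgroup.finiteIndex_of_le h
  let : Fintype (G ⧸ V) := Fintype.ofFinite _
  let : Fintype (G ⧸ U) := Fintype.ofFinite _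
  have : Finite (U ⧸ V.subgroupOf U) := inferInstance
  let : Fintype (U ⧸ V.subgroupOf U) := Fintype.ofFinite _
  have hsingle : ∀ y : G, θ (Pi.single (y : G ⧸ V) 1) = θ (Pi.single ((1 : G) : G ⧸ V) 1) := by
    intro y
    rw [← hθ y (Pi.single ((1 : G) : G ⧸ V) 1)]
    congr 1
    funext q
    obtain ⟨z, rfl⟩ := QuotientGroup.mk_surjective q
    rw [permModule_apply, Pi.single_apply, Pi.single_apply]
    congr 1
    change _ = (((y⁻¹ * z : G) : G ⧸ V) = ((1 : G) : G ⧸ V))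
    rw [eq_iff_iff, QuotientGroup.eq, QuotientGroup.eq]
    simp
  have hsum : ∀ ψ : G ⧸ V → ZMod p, θ ψ = (∑ q, ψ q) * θ (Pi.single ((1 : G) : G ⧸ V) 1) := by
    intro ψ
    have hψ : ψ = ∑ q, ψ q • (Pi.single q 1 : G ⧸ V → ZMod p) := by
      funext q
      simp [Pi.single_apply]
    conv_lhs => rw [hψ]
    rw [map_sum, Finset.sum_mul]
    refine Finset.sum_congr rfl fun q _ => ?_
    obtain ⟨y, rfl⟩ := QuotientGroup.mk_surjective q
    rw [ZMod.map_smul, hsingle, smul_eq_mul]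
  rw [hsum, ← (Subgroup.quotientEquivProdOfLE h).symm.sum_comp, Fintype.sum_prod_type]
  have hmap : ∀ (a : G ⧸ U) (b : U ⧸ V.subgroupOf U),
      permModuleMap p h φ ((Subgroup.quotientEquivProdOfLE h).symm (a, b)) = φ a := by
    intro a b
    obtain ⟨q, hq⟩ := (Subgroup.quotientEquivProdOfLE h).surjective (a, b)
    rw [← hq, Equiv.symm_apply_apply]
    obtain ⟨y, rfl⟩ := QuotientGroup.mk_surjective q
    exact congrArg φ (congrArg Prod.fst hq)
  simp only [hmap, Finset.sum_const, Finset.card_univ]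
  have hcard : ((Fintype.card (U ⧸ V.subgroupOf U) : ℕ) : ZMod p) = 0 := by
    rw [ZMod.natCast_eq_zero_iff, ← Nat.card_eq_fintype_card]
    exact hp
  simp [hcard]

end Permutation

section Retraction

variable {G : Type*} [Group G]

/-- Write `g = u t` with `u ∈ HW` and `t` a representative of the right coset `HW g`, then replace
`u` by an element of `H` congruent to it modulo `W`. -/
theorem exists_retraction_mod_normal (H W : Subgroup G) [W.Normal] : ∃ r : G → H,
    (∀ h : H, ((r h : G) : G ⧸ W) = (h : G)) ∧
    (∀ u ∈ H ⊔ W, ∃ h : H, ∀ g, ((r (u * g) : G) : G ⧸ W) = (h : G) * (r g : G)) ∧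
    ∀ w ∈ W, ∀ g, ((r (g * w) : G) : G ⧸ W) = (r g : G) := by
  classical
  have hHW : ∀ u ∈ H ⊔ W, ∃ h : H, ((h : G) : G ⧸ W) = u := by
    intro u hu
    obtain ⟨h, hh, w, hw, rfl⟩ := Subgroup.mem_sup_of_normal_right.1 hu
    exact ⟨⟨h, hh⟩, QuotientGroup.eq.2 (by simpa using hw)⟩
  -- Inversion turns left coset representatives into right ones. The trivial coset is forced to have
  -- representative `1`, so that `r` is the identity on `H` modulo `W`.
  let t : G → G := fun g => if g ∈ H ⊔ W then 1 else ((g⁻¹ : G) : G ⧸ (H ⊔ W)).out⁻¹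
  have ht : ∀ u ∈ H ⊔ W, ∀ g, t (u * g) = t g := by
    intro u hu g
    have : (((u * g)⁻¹ : G) : G ⧸ (H ⊔ W)) = ((g⁻¹ : G) : G ⧸ (H ⊔ W)) :=
      QuotientGroup.eq.2 (by simpa using hu)
    simp only [t, this, Subgroup.mul_mem_cancel_left _ hu]
  have ht' : ∀ g, g * (t g)⁻¹ ∈ H ⊔ W := by
    intro g
    by_cases hg : g ∈ H ⊔ W
    · simp [t, hg]
    · obtain ⟨u, hu⟩ := QuotientGroup.mk_out_eq_mul (H ⊔ W) g⁻¹
      simp only [t, if_neg hg, inv_inv, hu, mul_inv_cancel_left]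
      exact u.2
  choose r hr using fun g => hHW _ (ht' g)
  refine ⟨r, fun h => ?_, fun u hu => ?_, fun w hw g => ?_⟩
  · rw [hr]
    have : (h : G) ∈ H ⊔ W := Subgroup.mem_sup_left h.2
    simp [t, this]
  · obtain ⟨h, hh⟩ := hHW u hu
    refine ⟨h, fun g => ?_⟩
    rw [hr, hr, hh, ht u hu, mul_assoc]
    rfl
  · have hgw : g * w = (g * w * g⁻¹) * g := by group
    have hw' : g * w * g⁻¹ ∈ W := Subgroup.Normal.conj_mem inferInstance w hw g
    rw [hr, hr, hgw, ht _ (Subgroup.mem_sup_right hw'), mul_assoc, QuotientGroup.mk_mul,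
      (QuotientGroup.eq_one_iff _).2 hw', one_mul]

end Retraction

/-! ### Closed subgroups of infinite index -/

section InfiniteIndex

variable {p m : ℕ} {G : Type u} [Group G] [TopologicalSpace G]

theorem IsProP.exists_forall_eq_of_mk_eq (hG : IsProP p G) {H : Subgroup G}
    (hH : IsClosed (H : Set G)) {ι A : Type*} [Finite ι] {f : (ι → H) → A}
    (hf : IsLocallyConstant f) : ∃ W : Subgroup G, W.Normal ∧ IsOpen (W : Set G) ∧
      ∀ x y : ι → H, (∀ i, ((x i : G) : G ⧸ W) = (y i : G)) → f x = f y := by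
  obtain ⟨U, -, hUo, hU⟩ := (hG.subgroup hH).exists_forall_mul_eq hf
  obtain ⟨S, hS, hSU⟩ := mem_nhds_subtype _ _ _ |>.1 (hUo.mem_nhds U.one_mem)
  obtain ⟨W, hW, hWo, hWS⟩ := hG.exists_openNormal hS
  refine ⟨W, hW, hWo, fun x y hxy => ?_⟩
  rw [← hU x (x⁻¹ * y) fun i => hSU (hWS ?_), mul_inv_cancel_left]
  exact QuotientGroup.eq.1 (hxy i)

/-- The open subgroup `HW` has finite index, so it contains some `x ∉ H`. As `H` is closed, `x ∉
HW'` for a small open normal `W' ≤ W`; thus `[HW : HW']` is a power of `p` other than `1`. -/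
theorem IsProP.exists_lt_sup [Fact p.Prime] (hG : IsProP p G) {H : Subgroup G}
    (hH : IsClosed (H : Set G)) (hind : ¬ H.FiniteIndex) {W : Subgroup G} (hWo : IsOpen (W : Set G)) :
    ∃ V : Subgroup G, IsOpen (V : Set G) ∧ H ≤ V ∧ V ≤ H ⊔ W ∧ p ∣ V.relIndex (H ⊔ W) := by
  have := hG.isTopologicalGroup
  have hUo : IsOpen ((H ⊔ W : Subgroup G) : Set G) := Subgroup.isOpen_mono le_sup_right hWo
  obtain ⟨x, hxU, hxH⟩ : ∃ x ∈ H ⊔ W, x ∉ H := by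
    by_contra! h
    have hHU : H ⊔ W = H := le_antisymm h le_sup_left
    exact hind (hHU ▸ hG.finiteIndex hUo)
  have hc : Continuous fun w : G => x * w⁻¹ := by fun_prop
  obtain ⟨W', hW', hWo', hx⟩ := hG.exists_openNormal (S := W ∩ (fun w : G => x * w⁻¹) ⁻¹' (H : Set G)ᶜ)
    (Filter.inter_mem (hWo.mem_nhds W.one_mem)
      ((hH.isOpen_compl.preimage hc).mem_nhds (by simpa using hxH)))
  have hle : H ⊔ W' ≤ H ⊔ W := sup_le_sup_left (fun w hw => (hx hw).1) H
  have hVo : IsOpen ((H ⊔ W' : Subgroup G) : Set G) := Subgroup.isOpen_mono le_sup_right hWo'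
  refine ⟨H ⊔ W', hVo, le_sup_left, hle, ?_⟩
  obtain ⟨k, hk⟩ := hG.exists_index_eq_pow hVo
  obtain ⟨j, -, hj⟩ := (Nat.dvd_prime_pow Fact.out).1 (hk ▸ Subgroup.relIndex_dvd_index_of_le hle :
    (H ⊔ W').relIndex (H ⊔ W) ∣ p ^ k)
  rcases j with _ | j
  · rw [pow_zero, Subgroup.relIndex_eq_one] at hj
    obtain ⟨h, hh, w, hw, hhw⟩ := Subgroup.mem_sup_of_normal_right.1 (hj hxU)
    refine absurd hh ?_
    have := (hx hw).2
    rw [← hhw] at this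
    simpa using this
  · exact hj ▸ dvd_pow_self p j.succ_ne_zero

theorem IsGPD.isAcyclic_subgroup [Fact p.Prime] (hG : IsGPD p (m + 1) G) {H : Subgroup G}
    (hH : IsClosed (H : Set G)) (hind : ¬ H.FiniteIndex) : IsAcyclic (trivialModule p H) m := by
  have hP := hG.isProP
  have := hP.isTopologicalGroup
  intro f hf
  obtain ⟨W, hW, hWo, hfW⟩ := hP.exists_forall_eq_of_mk_eq hH f.2.1
  obtain ⟨V, hVo, hHV, hVU, hdvd⟩ := hP.exists_lt_sup hH hind hWo
  obtain ⟨r, hr, hrU, hrW⟩ := exists_retraction_mod_normal H W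
  have := hP.finiteIndex hVo
  -- A cochain-level inverse of Shapiro's map. By `hF` the choice of coset representative is
  -- irrelevant: it changes the arguments, modulo `W`, by a left translation from `H`, under which
  -- `f` is invariant.
  let F : (Fin (m + 2) → G) → G ⧸ (H ⊔ W) → ZMod p := fun x q => f.1 fun i => r (q.out⁻¹ * x i)
  have hF : ∀ (x : Fin (m + 2) → G) (y : G), F x y = f.1 fun i => r (y⁻¹ * x i) := by
    intro x y
    obtain ⟨u, hu⟩ := QuotientGroup.mk_out_eq_mul (H ⊔ W) y
    obtain ⟨h, hh⟩ := hrU _ (inv_mem u.2)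
    have h₁ := f.2.2 h fun i => r (y⁻¹ * x i)
    rw [Representation.trivial_apply] at h₁
    rw [← h₁]
    refine hfW _ _ fun i => ?_
    rw [hu, mul_inv_rev, mul_assoc, hh]
    rfl
  have hFc : F ∈ cochains (permModule p (H ⊔ W)) (m + 1) := by
    refine ⟨isLocallyConstant_of_forall_mul_eq hWo fun x w hw => ?_, fun g x => ?_⟩
    · funext q
      refine hfW _ _ fun i => ?_
      rw [Pi.mul_apply, ← mul_assoc, hrW _ (hw i)]
    · funext q
      obtain ⟨y, rfl⟩ := QuotientGroup.mk_surjective q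
      rw [permModule_apply, hF]
      change _ = F x ((g⁻¹ * y : G) : G ⧸ (H ⊔ W))
      rw [hF]
      simp only [mul_inv_rev, inv_inv, mul_assoc]
  have hFd : (⟨F, hFc⟩ : cochains (permModule p (H ⊔ W)) (m + 1)) ∈
      cocycles (permModule p (H ⊔ W)) (m + 1) := by
    rw [cocycles, LinearMap.mem_ker]
    ext x q
    obtain ⟨y, rfl⟩ := QuotientGroup.mk_surjective q
    have := congrFun (congrArg Subtype.val hf) fun i => r (y⁻¹ * x i)
    refine Eq.trans ?_ this
    change (∑ i : Fin (m + 3), (-1 : ℤ) ^ (i : ℕ) • F (fun j => x (i.succAbove j))) y = _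
    rw [Finset.sum_apply]
    refine Finset.sum_congr rfl fun i _ => ?_
    rw [Pi.smul_apply, hF]
  obtain ⟨E, hE⟩ := hG.mem_coboundaries (A := G ⧸ V → ZMod p) (fun φ => by ext; simp)
    (isDiscreteModule_permModule hP hVo)
    ⟨mapCochains (permModuleMap p hVU) (permModuleMap_equivariant hVU) _ ⟨F, hFc⟩, by
      rw [cocycles, LinearMap.mem_ker, d_mapCochains, LinearMap.mem_ker.1 hFd, map_zero]⟩
    (fun θ => by
      convert zero_mem (coboundaries (trivialModule p G) (m + 1)) using 1
      ext x
      exact invariantForms_permModuleMap_eq_zero hVU hdvd θ.2 _)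
  -- The trivial coset of `V` is fixed by `H ≤ V`, so evaluating there gives an `H`-invariant
  -- cochain.
  refine ⟨⟨fun x => E.1 (fun i => (x i : G)) ((1 : G) : G ⧸ V), ?_, fun h x => ?_⟩, ?_⟩
  · exact (E.2.1.comp_continuous (f := fun (x : Fin (m + 1) → H) i => (x i : G)) (by fun_prop)).comp
      fun φ => φ ((1 : G) : G ⧸ V)
  · have := congrFun (E.2.2 (h : G) fun i => (x i : G)) ((1 : G) : G ⧸ V)
    rw [permModule_apply] at this
    refine this.trans ?_
    rw [Representation.trivial_apply]
    refine congrArg (E.1 fun i => (x i : G)) (QuotientGroup.eq.2 ?_)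
    simpa using hHV h.2
  · ext x
    have := congrFun (congrFun (congrArg Subtype.val hE) fun i => (x i : G)) ((1 : G) : G ⧸ V)
    refine Eq.trans ?_ (this.trans ?_)
    · change _ = (∑ i : Fin (m + 2), (-1 : ℤ) ^ (i : ℕ) •
        E.1 (fun j => (x (i.succAbove j) : G))) ((1 : G) : G ⧸ V)
      rw [Finset.sum_apply]
      rfl
    · change F (fun i => (x i : G)) ((1 : G) : G ⧸ (H ⊔ W)) = f.1 x
      rw [hF]
      refine hfW _ _ fun i => ?_
      rw [inv_one, one_mul, hr]

end InfiniteIndex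

end ProfiniteCohomology

theorem mainTheorem4 {p n : ℕ} (hp : p.Prime) (hn : 1 ≤ n)
    {G : Type u} [Group G] [TopologicalSpace G] (hG : ProfiniteCohomology.IsGPD p n G)
    (H : Subgroup G) (hH : IsClosed (H : Set G)) (hind : ¬ H.FiniteIndex) :
    ProfiniteCohomology.cd H < n := by
  have : Fact p.Prime := ⟨hp⟩
  obtain ⟨m, rfl⟩ : ∃ m, n = m + 1 := ⟨n - 1, by omega⟩
  refine lt_of_le_of_lt (sInf_le (a := (m : ℕ∞)) ?_) (by exact_mod_cast Nat.lt_succ_self m)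
  intro A _ ρ hρ hA q hq
  obtain ⟨k, rfl⟩ : ∃ k, q = m + k + 1 := ⟨q - m - 1, by
    have : m < q := by exact_mod_cast hq
    omega⟩
  exact (ProfiniteCohomology.isAcyclic_add (hG.isProP.subgroup hH)
    (hG.isAcyclic_subgroup hH hind) k hρ hA).subsingleton
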